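/- \textbf{Definitions.} Let $p$ be a prime. A finite $p$-group $G$ is of \emph{GK type} if $\mathcal K(G):=\{g\in G : |g|<\exp(G)\}$ is a maximal subgroup of $G$, called its \emph{GK kernel}. If $G$ is of GK type, put $\mathcal K^0(G):=G$ and $\mathcal K^{i+1}(G):=\mathcal K(\mathcal K^i(G))$, and iterate until the first $l\ge 1$ such that $\mathcal K^l(G)$ is not of GK type; then $\mathcal K^l(G)$ is the \emph{GK root} of $G$ and $l$ is its \emph{level}. For a finite $p$-group $R$ not of GK type, the \emph{GK tree} $\mathcal T(R)$ is the directed graph whose vertices are $R$ (of level $0$) and the isomorphism types of groups of GK type with GK root $R$, with one edge $G\to\mathcal K(G)$ for each vertex $G$ of GK type. A \emph{stem} is an infinite directed path $\cdots\to G_2\to G_1\to G_0=R$. For a finite $p$-group $H$ with $\exp(Z(H))=\exp(H)=p^e$ let $\mathcal Z(H):=\{h\in Z(H): |h|=p^e\}$. For $l\ge 1$ let $A_l(H)$ be the group of permutations of $\mathcal Z(H)$ of the form $h\mapsto (h^{\alpha})^k y$, where $\alpha\in\mathrm{Aut}(H)$, $k\in\mathbb Z_{p^e}^{*}$ and $y\in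 Z(H)^{p^l}$. For $h\in\mathcal Z(H)$ and $l\ge 1$ let $H_l(h):=(\langle\hat g\rangle\times H)/\langle(\hat g^{p^l},h^{-1})\rangle$, where $\hat g$ has order $p^{e+l}$. Write $G^{n}$ for the subgroup generated by all $n$-th powers in $G$, write $G^{(1)}$ for the derived subgroup, and let the rank $r(G)$ be the minimal number of generators of $G$. \textbf{Statement.} Let $p$ be an odd prime, let $e\ge 1$, and let $$E:=(\langle z\rangle\times\langle y\rangle)\rtimes\langle x\rangle\cong(C_{p^e}\times C_{p^e})\rtimes C_{p^e},\qquad [y,x]=y^{-1}x^{-1}yx=z,\quad [z,x]=1,$$ and $R:=\langle w\rangle\times E$ with $\langle w\rangle\cong C_{p^e}$. For $1\le a\le e-1$ put $$\mathcal O_0:=\{w^iz^j : p\nmid i\},\qquad \mathcal O_a:=\{w^{ip^a}z^j : p\nmid i,\ p\nmid j\},\qquad \mathcal O_e:=\{z^j : p\nmid j\},$$ and let $\widetilde{\mathcal O}_l:=\mathcal O_l\cup\dots\cup\mathcal O_e$ for $1\le l\le e$. (a) $R$ is a $p$-group of rank $3$ with $\exp(R)=\exp(Z(R))=p^e$, it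 is not of GK type, and $\mathcal T(R)$ is infinite. (b) We have $\mathcal O_0=\mathcal Z(R)\setminus R^pR^{(1)}$; $\mathcal O_a=\mathcal Z(R)\cap(R^{p^a}R^{(1)}\setminus R^{p^{a+1}}R^{(1)})$ for $1\le a\le e-1$; and $\mathcal O_e=\mathcal Z(R)\cap R^{p^e}R^{(1)}$. Their cardinalities are $|\mathcal O_0|=p^{2e-1}(p-1)$, $|\mathcal O_a|=p^{2e-2-a}(p-1)^2$ for $1\le a\le e-1$, and $|\mathcal O_e|=p^{e-1}(p-1)$. For $1\le l\le e$ the $A_l(R)$-orbits in $\mathcal Z(R)$ are precisely $\mathcal O_0,\dots,\mathcal O_{l-1},\widetilde{\mathcal O}_l$; in particular there are exactly $e+1$ $A_e(R)$-orbits, namely $\mathcal O_0,\dots,\mathcal O_e$. (c) $\mathcal T(R)$ has exactly $e+1$ stems $S_0,\dots,S_e$, where $S_a$ belongs to the orbit $\mathcal O_a$ in the sense that for all $l\ge 1$ its vertex $S_a(l)$ of level $l$ is the isomorphism type of $R_l(h)$, for any $h\in\mathcal O_a$. (d) For $a,b\in\{0,\dots,e\}$ and $l\ge 0$ we have $S_a(l)=S_b(l)$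 if and only if $a=b$ or $l\le\min\{a,b\}$. For each $l\in\{0,\dots,e-1\}$ there is a two-fold branching of stems at level $l$: there are exactly two vertices $G$ lying on stems with $\mathcal K(G)=S_e(l)$, namely the two distinct vertices $S_l(l+1)$ and $S_e(l+1)$. There is no further branching of stems: if $a<l$ or $l\ge e$, then $S_a(l+1)$ is the only vertex $G$ lying on a stem with $\mathcal K(G)=S_a(l)$. (e) For all $l\ge 1$ the group $S_0(l)$ has rank $3$, and for all $l\ge1$ and $1\le a\le e$ the group $S_a(l)$ has rank $4$. -/

import Mathlib

noncomputable section

namespace GKTrees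

/-! ## Groups of Gorenstein-Kulkarni type -/

/-- The set of all elements of non-maximal order. -/
def kernelSet (G : Type) [Group G] : Set G := {g | orderOf g < Monoid.exponent G}

/-- The subgroup generated by the elements of non-maximal order; for a group of GK type this is
the GK kernel, since then `kernelSet G` is itself a subgroup. -/
def kernel (G : Type) [Group G] : Subgroup G := Subgroup.closure (kernelSet G)

/-- `G` is a finite `p`-group of GK type: the set of all elements of non-maximal order is
a maximal subgroup of `G`. -/
def IsGK (p : ℕ) (G : Type) [Group G] : Prop :=
  IsPGroup p G ∧ Finite G ∧ ∃ M : Subgroup G, IsCoatom M ∧ (M : Set G) = kernelSet G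

/-- The GK series `G = K⁰(G), K¹(G), K²(G), …`, obtained by iterating the GK kernel. -/
def series (G : Type) [Group G] : ℕ → Subgroup G
  | 0 => ⊤
  | i + 1 => (kernel (series G i)).map (series G i).subtype

/-- `G` has GK level `l` and GK root (isomorphic to) `R`. -/
def HasRoot (p : ℕ) (G R : Type) [Group G] [Group R] (l : ℕ) : Prop :=
  (∀ i < l, IsGK p (series G i)) ∧ ¬ IsGK p (series G l) ∧ Nonempty (series G l ≃* R)

/-! ## Isomorphism types of finite groups, GK trees and their stems -/

/-- Isomorphism of finite groups. -/
instance isoSetoid : Setoid FiniteGrp.{0} where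
  r G H := Nonempty (G ≃* H)
  iseqv := ⟨fun _ => ⟨MulEquiv.refl _⟩, fun ⟨f⟩ => ⟨f.symm⟩, fun ⟨f⟩ ⟨g⟩ => ⟨f.trans g⟩⟩

/-- Isomorphism types of finite groups. -/
def IsoType : Type 1 := Quotient isoSetoid

/-- The isomorphism type of a finite group. -/
def isoType (G : Type) [Group G] [Finite G] : IsoType := Quotient.mk isoSetoid (FiniteGrp.of G)

/-- The rank (minimal number of generators) of an isomorphism type of finite groups. -/
def IsoType.rank : IsoType → ℕ :=
  Quotient.lift (fun G : FiniteGrp.{0} => Group.rank G) fun _ _ ⟨f⟩ => Group.rank_congr f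

theorem isoType_eq_iff {G H : Type} [Group G] [Finite G] [Group H] [Finite H] :
    isoType G = isoType H ↔ Nonempty (G ≃* H) :=
  Quotient.eq (r := isoSetoid)

theorem rank_isoType (G : Type) [Group G] [Finite G] : (isoType G).rank = Group.rank G := rfl

/-- The vertices of the GK tree `T(R)`: the root `R`, and the isomorphism types of all finite
`p`-groups of GK type having `R` as their GK root. -/
def vertices (p : ℕ) (R : Type) [Group R] [Finite R] : Set IsoType :=
  {c | c = isoType R ∨ ∃ (G : Type) (_ : Group G) (_ : Finite G), c = isoType G ∧ IsGK p G ∧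
    ∃ l, 1 ≤ l ∧ HasRoot p G R l}

/-- The GK tree `T(R)`: from any vertex `G` of GK type there is precisely one edge,
and it ends in the GK kernel of `G`. -/
def tree (p : ℕ) (R : Type) [Group R] [Finite R] : Digraph (vertices p R) where
  Adj c d := ∃ (G : Type) (_ : Group G) (_ : Finite G), (c : IsoType) = isoType G ∧ IsGK p G ∧
    (d : IsoType) = isoType (kernel G)

/-- The root, as a vertex of its tree. -/
def root (p : ℕ) (R : Type) [Group R] [Finite R] : vertices p R := ⟨isoType R, Or.inl rfl⟩

/-- A stem of `T(R)`: an infinite directed path `⋯ → G₂ → G₁ → G₀ = R` ending in the root. -/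
def Stem (p : ℕ) (R : Type) [Group R] [Finite R] : Type 1 :=
  {s : ℕ → vertices p R // s 0 = root p R ∧ ∀ l, (tree p R).Adj (s (l + 1)) (s l)}

/-- The vertex of level `l` on a stem. -/
def Stem.at {p : ℕ} {R : Type} [Group R] [Finite R] (s : Stem p R) (l : ℕ) : vertices p R :=
  s.1 l

/-- The vertices lying on stems which have an edge to the vertex `v`; their number is the number
of stems into which a stem branches at `v`. -/
def stemChildren (p : ℕ) (R : Type) [Group R] [Finite R] (v : vertices p R) :
    Set (vertices p R) :=
  {u | (∃ (s : Stem p R) (l : ℕ), s.at l = u) ∧ (tree p R).Adj u v}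

/-! ## Trivial cyclic extensions -/

/-- The central subgroup generated by `(ĝ ^ d, h⁻¹)` in the parent group `⟨ĝ⟩ × H`, where
`ĝ` has order `d * |h|`. -/
def amalgKernel {H : Type} [Group H] (d : ℕ) (h : Subgroup.center H) :
    Subgroup (Multiplicative (ZMod (d * orderOf (h : H))) × H) :=
  Subgroup.zpowers ((Multiplicative.ofAdd 1) ^ d, ((h⁻¹ : Subgroup.center H) : H))

instance amalgKernel_normal {H : Type} [Group H] (d : ℕ) (h : Subgroup.center H) :
    (amalgKernel d h).Normal := by
  have hc : amalgKernel d h ≤ Subgroup.center _ := by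
    refine (Subgroup.zpowers_le).2 (Subgroup.mem_center_iff.2 fun x => ?_)
    exact Prod.ext (mul_comm _ _) (Subgroup.mem_center_iff.1 (h⁻¹).2 x.2)
  refine ⟨fun n hn g => ?_⟩
  rwa [Subgroup.mem_center_iff.1 (hc hn) g, mul_inv_cancel_right]

/-- The trivial cyclic extension of `H` of degree `d` belonging to `h ∈ Z(H)`: the central
amalgamation of `⟨ĝ⟩` and `H`, where `ĝ` has order `d * |h|` and `ĝ ^ d` is identified
with `h`. -/
abbrev TrivExt {H : Type} [Group H] (d : ℕ) (h : Subgroup.center H) : Type :=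
  (Multiplicative (ZMod (d * orderOf (h : H))) × H) ⧸ amalgKernel d h

instance trivExt_finite {H : Type} [Group H] [Finite H] (d : ℕ) [NeZero d]
    (h : Subgroup.center H) : Finite (TrivExt d h) := by
  have : NeZero (d * orderOf (h : H)) :=
    ⟨mul_ne_zero (NeZero.ne d) (orderOf_pos (h : H)).ne'⟩
  infer_instance

/-! ## The action on central elements of maximal order -/

/-- The subgroup `G ^ n` generated by all `n`-th powers. -/
def powSubgroup (G : Type) [Group G] (n : ℕ) : Subgroup G :=
  Subgroup.closure (Set.range fun x : G => x ^ n)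

/-- The set `𝒵(H)` of all central elements of order `exp(H)`. -/
def maxCentral (H : Type) [Group H] : Set H :=
  {z | z ∈ Subgroup.center H ∧ orderOf z = Monoid.exponent H}

/-- The permutation group `A_l(H)` on `𝒵(H)`: for `l ≥ 1` it is generated by the action of
`(Aut(H) × ℤ_{exp(H)}^*) ⋉ Z(H)^{p^l}` via `z ↦ (z ^ α) ^ k * y`, while `A_0(H)` is the full
symmetric group. -/
def permGroup (p : ℕ) (H : Type) [Group H] (l : ℕ) : Subgroup (Equiv.Perm (maxCentral H)) :=
  if l = 0 then ⊤ else
    Subgroup.closure {σ | ∃ (α : MulAut H) (k : ℕ)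
      (y : powSubgroup (Subgroup.center H) (p ^ l)), Nat.Coprime k (Monoid.exponent H) ∧
      ∀ z : maxCentral H, (σ z : H) = (α (z : H)) ^ k * ((y : Subgroup.center H) : H)}

/-- The set of `A_l(H)`-orbits in `𝒵(H)`, viewed as subsets of `H`. -/
def permOrbits (p : ℕ) (H : Type) [Group H] (l : ℕ) : Set (Set H) :=
  Set.range fun z : maxCentral H => Subtype.val '' MulAction.orbit (permGroup p H l) z

/-! ## The groups `E` and `R`

All cyclic groups are of order `n`, and are written as `Multiplicative (ZMod n)`. -/

/-- The action of `⟨x⟩` on `⟨z⟩ × ⟨y⟩` by `x y x⁻¹ = y z⁻¹` and `x z x⁻¹ = z`. -/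
def shear (n : ℕ) : Multiplicative (ZMod n) →*
    MulAut (Multiplicative (ZMod n) × Multiplicative (ZMod n)) where
  toFun i :=
    { toFun := fun v => (Multiplicative.ofAdd (v.1.toAdd - i.toAdd * v.2.toAdd), v.2)
      invFun := fun v => (Multiplicative.ofAdd (v.1.toAdd + i.toAdd * v.2.toAdd), v.2)
      left_inv := fun v => by simp
      right_inv := fun v => by simp
      map_mul' := fun v u => by
        refine Prod.ext ?_ rfl
        apply Multiplicative.toAdd.injective
        simp only [Prod.fst_mul, Prod.snd_mul, toAdd_mul, toAdd_ofAdd]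
        ring }
  map_one' := by ext v <;> simp
  map_mul' i j := by
    refine MulEquiv.ext fun v => Prod.ext ?_ rfl
    apply Multiplicative.toAdd.injective
    simp only [MulAut.mul_apply, MulEquiv.coe_mk, Equiv.coe_fn_mk, toAdd_mul, toAdd_ofAdd]
    ring

theorem shear_apply (n : ℕ) (i : Multiplicative (ZMod n))
    (v : Multiplicative (ZMod n) × Multiplicative (ZMod n)) :
    shear n i v = (Multiplicative.ofAdd (v.1.toAdd - i.toAdd * v.2.toAdd), v.2) := rfl

/-- `E = (⟨z⟩ × ⟨y⟩) ⋊ ⟨x⟩`, where `[y, x] = z` and `[z, x] = 1`. -/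
abbrev E (n : ℕ) : Type :=
  (Multiplicative (ZMod n) × Multiplicative (ZMod n)) ⋊[shear n] Multiplicative (ZMod n)

instance finite_E (n : ℕ) [NeZero n] : Finite (E n) :=
  Finite.of_equiv _ SemidirectProduct.equivProd.symm

/-- `R = ⟨w⟩ × E`. -/
abbrev R (n : ℕ) : Type := Multiplicative (ZMod n) × E n

/-- The generator `w` of the left hand direct factor. -/
def w (n : ℕ) : R n := (Multiplicative.ofAdd 1, 1)

/-- The generator `z` of the centre of `E`. -/
def z (n : ℕ) : R n := (1, SemidirectProduct.inl (Multiplicative.ofAdd 1, 1))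

/-- The generator `y` of `E`. -/
def y (n : ℕ) : R n := (1, SemidirectProduct.inl (1, Multiplicative.ofAdd 1))

/-- The generator `x` of `E`. -/
def x (n : ℕ) : R n := (1, SemidirectProduct.inr (Multiplicative.ofAdd 1))

theorem commutator_y_x (n : ℕ) : (y n)⁻¹ * (x n)⁻¹ * y n * x n = z n := by
  rw [mul_assoc, mul_assoc, inv_mul_eq_iff_eq_mul, inv_mul_eq_iff_eq_mul]
  ext <;> simp [x, y, z, shear_apply]

theorem commutator_z_x (n : ℕ) : (z n)⁻¹ * (x n)⁻¹ * z n * x n = 1 := by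
  rw [mul_assoc, mul_assoc, inv_mul_eq_iff_eq_mul, inv_mul_eq_iff_eq_mul]
  ext <;> simp [x, z, shear_apply]

/-- The sets `𝒪_0, …, 𝒪_e`, for `e ≥ 1`:
`𝒪_0 = {w^i z^j ; p ∤ i}`, `𝒪_a = {w^(i p^a) z^j ; p ∤ i, p ∤ j}` for `1 ≤ a ≤ e - 1`, and
`𝒪_e = {z^j ; p ∤ j}`. -/
def O (p e a : ℕ) : Set (R (p ^ e)) :=
  if a = 0 then {g | ∃ i j : ℕ, ¬ p ∣ i ∧ g = w (p ^ e) ^ i * z (p ^ e) ^ j}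
  else if a < e then
    {g | ∃ i j : ℕ, ¬ p ∣ i ∧ ¬ p ∣ j ∧ g = w (p ^ e) ^ (i * p ^ a) * z (p ^ e) ^ j}
  else {g | ∃ j : ℕ, ¬ p ∣ j ∧ g = z (p ^ e) ^ j}

/-- The union of `𝒪_l, …, 𝒪_e`. -/
def Otilde (p e l : ℕ) : Set (R (p ^ e)) := ⋃ a ∈ Set.Icc l e, O p e a

end GKTrees

end

/-!
All stems come from trivial cyclic extensions of the root.

*Stems.* If `H` lies `t` levels below `G` on a stem, then `H` is embedded in `G` as the normal
subgroup of all elements of order dividing `exp(H)`, and `exp(G) = p ^ t * exp(H)` (`IsUp`). For an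
element `g` of maximal order in `G`, the power `g ^ p ^ t` lies in `H`, has maximal order there, and
acts on `H` as the `p ^ t`-th power of an automorphism of `p`-power order. Above `H` the stem is
infinite, so `t` may be taken so large that this action is trivial: `H` has a central element `c` of
maximal order (`Stem.exists_central`). When `H` is the vertex of level `l` and `R` is the root, a
count of elements shows that `H` is the central amalgamation of `⟨c⟩` and `R`, that is, the trivial
cyclic extension of degree `p ^ l` belonging to `c ^ p ^ l` (`Stem.exists_isTrivExt`).

*Trivial cyclic extensions.* `IsTrivExt` characterises them without a quotient construction. If `h`
is central of order `exp(R)`, the extension of degree `p ^ (l + 1)` is of GK type and its kernel is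
the extension of degree `p ^ l` (`IsTrivExt.isGK_and_kernel`), so each `h` gives a stem. As `R`
consists of the elements of order dividing `exp(R)`, an isomorphism between two extensions restricts
to an automorphism of `R`; so extensions are isomorphic exactly when they belong to the same
`A_l(R)`-orbit (`nonempty_trivExt_equiv_iff`).

*Orbits.* The group `A_l(R)` preserves membership in the characteristic subgroups
`R ^ (p ^ b) * R'` for `b ≤ l` (`PermRel.mem_powCommutator_iff`), and `w ^ i * z ^ j` lies in this
subgroup exactly when `p ^ b ∣ i`. This separates the claimed orbits. Transitivity on each of them
comes from the automorphisms `w ↦ w ^ s * z ^ t` which fix `E`, together with powers and, on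
`𝒪_l ∪ ⋯ ∪ 𝒪_e`, multiplication by `w ^ (k * p ^ l)` (`permRel_baseO`, `permRel_z`).

From level `e` on the types belonging to different `𝒪_a` are distinct, hence a stem stays in one of
them, and its vertices below level `e` are iterated kernels (`Stem.exists_eq_stemO`). The ranks are
found by mapping onto elementary abelian groups.
-/

noncomputable section

namespace GKTrees

section

/-! ### Trivial cyclic extensions -/

variable {H G G' : Type} [Group H] [Group G] [Group G']

/-- `G` is the central amalgamation of `⟨c⟩` and `H` (embedded by `ι`), where `c ^ d` is
identified with `h` and `⟨c⟩` meets the image of `H` in `⟨c ^ d⟩`. This characterises the trivial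
cyclic extension of degree `d` belonging to `h` without reference to a construction. -/
structure IsTrivExt (d : ℕ) (h : H) (c : G) (ι : H →* G) : Prop where
  inj : Function.Injective ι
  comm : ∀ g, Commute c g
  pow_eq : c ^ d = ι h
  dvd : ∀ i : ℤ, c ^ i ∈ ι.range → (d : ℤ) ∣ i
  gen : ∀ g, ∃ (i : ℤ) (r : H), g = c ^ i * ι r

namespace IsTrivExt

theorem injective_pow_mul {d : ℕ} {c : G} {ι : H →* G} (inj : Function.Injective ι)
    (dvd : ∀ i : ℤ, c ^ i ∈ ι.range → (d : ℤ) ∣ i) :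
    Function.Injective fun q : Fin d × H => c ^ (q.1 : ℕ) * ι q.2 := by
  rintro ⟨i, r⟩ ⟨j, s⟩ hq
  simp only at hq
  have h1 : c ^ ((i : ℤ) - (j : ℤ)) = ι (s * r⁻¹) := by
    rw [sub_eq_neg_add, zpow_add, zpow_neg, zpow_natCast, zpow_natCast, map_mul, map_inv,
      inv_mul_eq_iff_eq_mul, ← mul_assoc, eq_mul_inv_iff_mul_eq, hq]
  have h2 := dvd _ ⟨_, h1.symm⟩
  have h3 : (i : ℕ) = j := by
    have hi := i.2
    have hj := j.2
    have := Int.eq_zero_of_abs_lt_dvd h2 (by rw [abs_lt]; omega)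
    omega
  have h4 : i = j := Fin.ext h3
  subst h4
  exact Prod.ext rfl (inj (mul_left_cancel hq))

/-- When `G` has the right order, it is generated by `c` and the image of `H`. -/
theorem of_card [Finite G] {d : ℕ} {h : H} {c : G} {ι : H →* G}
    (inj : Function.Injective ι) (comm : ∀ g, Commute c g) (pow_eq : c ^ d = ι h)
    (dvd : ∀ i : ℤ, c ^ i ∈ ι.range → (d : ℤ) ∣ i)
    (card : Nat.card G = d * Nat.card H) : IsTrivExt d h c ι := by
  refine ⟨inj, comm, pow_eq, dvd, fun g => ?_⟩
  have hb := (Nat.bijective_iff_injective_and_card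
    (fun q : Fin d × H => c ^ (q.1 : ℕ) * ι q.2)).2
    ⟨injective_pow_mul inj dvd, by simp [Nat.card_prod, card]⟩
  obtain ⟨q, hq⟩ := hb.2 g
  exact ⟨(q.1 : ℕ), q.2, by rw [← hq, zpow_natCast]⟩

section
variable {d : ℕ} {h : H} {c : G} {ι : H →* G} (T : IsTrivExt d h c ι)
include T

theorem card_eq (hd : d ≠ 0) : Nat.card G = d * Nat.card H := by
  have hb : Function.Bijective fun q : Fin d × H => c ^ (q.1 : ℕ) * ι q.2 := by
    refine ⟨injective_pow_mul T.inj T.dvd, fun g => ?_⟩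
    obtain ⟨i, r, rfl⟩ := T.gen g
    have hd' : (0 : ℤ) < d := by exact_mod_cast Nat.pos_of_ne_zero hd
    have h0 := Int.emod_nonneg i hd'.ne'
    have h1 := Int.emod_lt_of_pos i hd'
    refine ⟨(⟨(i % d).toNat, by omega⟩, h ^ (i / d) * r), ?_⟩
    simp only
    rw [← zpow_natCast, Int.toNat_of_nonneg h0, map_mul, map_zpow, ← T.pow_eq, ← mul_assoc,
      ← zpow_natCast, ← zpow_mul, ← zpow_add, Int.emod_add_mul_ediv]
  rw [← Nat.card_congr (Equiv.ofBijective _ hb)]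
  simp [Nat.card_prod]

theorem pow_mul_map (i : ℤ) (r : H) (n : ℕ) : (c ^ i * ι r) ^ n = c ^ (i * n) * ι (r ^ n) := by
  rw [((T.comm (ι r)).zpow_left i).mul_pow, zpow_mul, zpow_natCast, map_pow]

theorem map_equiv (f : G ≃* G') : IsTrivExt d h (f c) (f.toMonoidHom.comp ι) where
  inj := f.injective.comp T.inj
  comm g := by
    have := (T.comm (f.symm g)).map f
    simpa using this
  pow_eq := by rw [← map_pow, T.pow_eq]; rfl
  dvd i hi := by
    obtain ⟨r, hr⟩ := hi
    refine T.dvd i ⟨r, f.injective ?_⟩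
    rw [map_zpow]; exact hr
  gen g := by
    obtain ⟨i, r, hr⟩ := T.gen (f.symm g)
    refine ⟨i, r, ?_⟩
    rw [← f.apply_symm_apply g, hr]; simp

end

/-- A trivial cyclic extension, as constructed, has the characterising property. -/
theorem exists_trivExt [Finite H] {d : ℕ} (hd : d ≠ 0) (h : Subgroup.center H) :
    ∃ (c : TrivExt d h) (ι : H →* TrivExt d h), IsTrivExt d (h : H) c ι := by
  let N := amalgKernel d h
  have ho : orderOf (h : H) ≠ 0 := (orderOf_pos (h : H)).ne'
  -- the components of an element of the amalgamated subgroup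
  have key : ∀ (i : ℤ) (r : H), ((Multiplicative.ofAdd 1 : Multiplicative
      (ZMod (d * orderOf (h : H)))) ^ i, r) ∈ N →
      ∃ k : ℤ, ((d * orderOf (h : H) : ℕ) : ℤ) ∣ d * k - i ∧ r = (h : H) ^ (-k) := by
    intro i r hr
    obtain ⟨k, hk⟩ := Subgroup.mem_zpowers_iff.1 hr
    refine ⟨k, ?_, ?_⟩
    · have h1 := congrArg (fun q => q.1.toAdd) hk
      simp only [Prod.pow_fst, toAdd_zpow, toAdd_pow, toAdd_ofAdd] at h1
      rw [← ZMod.intCast_zmod_eq_zero_iff_dvd]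
      simp at h1
      push_cast
      rw [← h1]; ring
    · have h2 := congrArg (fun q => q.2) hk
      simp only [Prod.pow_snd] at h2
      rw [← h2]; simp
  refine ⟨QuotientGroup.mk' N (Multiplicative.ofAdd 1, 1),
    (QuotientGroup.mk' N).comp (MonoidHom.inr _ _), ?_, ?_, ?_, ?_, ?_⟩
  · rw [injective_iff_map_eq_one]
    intro r hr
    have hr' : ((1 : Multiplicative (ZMod (d * orderOf (h : H)))), r) ∈ N :=
      (QuotientGroup.eq_one_iff _).1 hr
    obtain ⟨k, hk, rfl⟩ := key 0 r (by simpa using hr')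
    rw [sub_zero, Nat.cast_mul] at hk
    have := Int.dvd_of_mul_dvd_mul_left (Nat.cast_ne_zero.2 hd) hk
    rw [zpow_neg, inv_eq_one]
    exact orderOf_dvd_iff_zpow_eq_one.1 this
  · intro g
    obtain ⟨g, rfl⟩ := QuotientGroup.mk'_surjective N g
    refine Commute.map (f := QuotientGroup.mk' N) ?_
    exact Prod.ext (mul_comm _ _) (by simp)
  · rw [← map_pow]
    refine QuotientGroup.eq.2 ?_
    have : ((Multiplicative.ofAdd 1 : Multiplicative (ZMod (d * orderOf (h : H)))) ^ d,
        ((h⁻¹ : Subgroup.center H) : H))⁻¹ ∈ N := N.inv_mem (Subgroup.mem_zpowers _)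
    convert this using 1
    ext <;> simp
  · rintro i ⟨r, hr⟩
    rw [← map_zpow] at hr
    have := QuotientGroup.eq.1 hr
    obtain ⟨k, hk, -⟩ := key i r⁻¹ (by simpa using this)
    have h1 : (d : ℤ) ∣ d * k - i := (Dvd.intro _ (by push_cast; rfl)).trans hk
    exact (dvd_sub_right (Dvd.intro _ rfl)).1 h1
  · intro g
    obtain ⟨⟨a, r⟩, rfl⟩ := QuotientGroup.mk'_surjective N g
    obtain ⟨i, hi⟩ := ZMod.intCast_surjective a.toAdd
    refine ⟨i, r, ?_⟩
    rw [← map_zpow]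
    have : (a, r) = (Multiplicative.ofAdd 1, 1) ^ i * MonoidHom.inr _ _ r := by
      ext
      · apply Multiplicative.toAdd.injective
        simp [← hi]
      · simp
    rw [this, map_mul]; rfl

/-- The characterising property determines the group up to isomorphism. -/
theorem nonempty_equiv [Finite H] {d : ℕ} {h : Subgroup.center H} {c : G}
    {ι : H →* G} (T : IsTrivExt d (h : H) c ι) : Nonempty (TrivExt d h ≃* G) := by
  have hc : c ^ (d * orderOf (h : H)) = 1 := by
    rw [pow_mul, T.pow_eq, ← map_pow, pow_orderOf_eq_one, map_one]
  let f : Multiplicative (ZMod (d * orderOf (h : H))) →* G :=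
    AddMonoidHom.toMultiplicativeLeft (ZMod.lift (d * orderOf (h : H))
      ⟨zmultiplesHom (Additive G) (Additive.ofMul c), by
        simp only [zmultiplesHom_apply, natCast_zsmul]
        exact congrArg Additive.ofMul hc⟩)
  have hf : ∀ i : ℤ, f (Multiplicative.ofAdd (i : ZMod (d * orderOf (h : H)))) = c ^ i := by
    intro i
    simp only [f, AddMonoidHom.toMultiplicativeLeft_apply_apply, toAdd_ofAdd, ZMod.lift_coe,
      zmultiplesHom_apply]
    rfl
  have hfc : ∀ (a) (r : H), Commute (f a) (ι r) := by
    intro a r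
    obtain ⟨i, hi⟩ := ZMod.intCast_surjective a.toAdd
    have : a = Multiplicative.ofAdd (i : ZMod (d * orderOf (h : H))) := by rw [hi]; rfl
    rw [this, hf]
    exact (T.comm _).zpow_left i
  let F := MonoidHom.noncommCoprod f ι hfc
  have hF : ∀ (i : ℤ) (r : H), F (Multiplicative.ofAdd (i : ZMod (d * orderOf (h : H))), r) =
      c ^ i * ι r := fun i r => by
    rw [MonoidHom.noncommCoprod_apply, hf]
  have hk : F.ker = amalgKernel d h := by
    ext ⟨a, r⟩
    obtain ⟨i, hi⟩ := ZMod.intCast_surjective a.toAdd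
    have : a = Multiplicative.ofAdd (i : ZMod (d * orderOf (h : H))) := by rw [hi]; rfl
    subst this
    rw [MonoidHom.mem_ker, hF, amalgKernel, Subgroup.mem_zpowers_iff]
    constructor
    · intro h1
      obtain ⟨k, rfl⟩ := T.dvd i ⟨r⁻¹, by rw [map_inv, eq_inv_of_mul_eq_one_left h1]⟩
      refine ⟨k, Prod.ext ?_ ?_⟩
      · apply Multiplicative.toAdd.injective
        simp [mul_comm]
      · apply T.inj
        rw [zpow_mul, zpow_natCast, T.pow_eq, ← map_zpow, ← map_mul, ← map_one ι] at h1
        have h2 := T.inj h1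
        simp only [Prod.pow_snd]
        rw [eq_inv_of_mul_eq_one_right h2]
        simp
    · rintro ⟨k, hk⟩
      rw [← hF, ← hk, map_zpow]
      have : F ((Multiplicative.ofAdd 1) ^ d, ((h⁻¹ : Subgroup.center H) : H)) = 1 := by
        have := hF d ((h⁻¹ : Subgroup.center H) : H)
        rw [zpow_natCast, T.pow_eq, ← map_mul] at this
        simp only [InvMemClass.coe_inv, mul_inv_cancel, map_one] at this
        rw [← this]
        congr 1
        refine Prod.ext ?_ (by simp)
        apply Multiplicative.toAdd.injective
        simp
      rw [this, one_zpow]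
  refine ⟨(QuotientGroup.quotientMulEquivOfEq hk.symm).trans
    (QuotientGroup.quotientKerEquivOfSurjective F fun g => ?_)⟩
  obtain ⟨i, r, rfl⟩ := T.gen g
  exact ⟨_, hF i r⟩

end IsTrivExt

end

section

/-! ### The GK kernel and the GK series under isomorphisms -/

variable {H G G' : Type} [Group H] [Group G] [Group G']

/-- If the elements of non-maximal order form a subgroup, it is the GK kernel. -/
theorem kernel_eq_of_coe {M : Subgroup G} (h : (M : Set G) = kernelSet G) : kernel G = M := by
  rw [kernel, ← h, Subgroup.closure_eq]

theorem preimage_kernelSet (f : G ≃* G') : f ⁻¹' kernelSet G' = kernelSet G := by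
  ext g
  simp [kernelSet, MulEquiv.orderOf_eq, Monoid.exponent_eq_of_mulEquiv f]

theorem map_kernel (f : G ≃* G') : (kernel G).map f.toMonoidHom = kernel G' := by
  rw [kernel, MonoidHom.map_closure, kernel, ← preimage_kernelSet f]
  congr 1
  exact Set.image_preimage_eq _ f.surjective

theorem nonempty_kernel_equiv (f : G ≃* G') : Nonempty (kernel G ≃* kernel G') :=
  ⟨(f.subgroupMap (kernel G)).trans (MulEquiv.subgroupCongr (map_kernel f))⟩

theorem IsGK.of_equiv {p : ℕ} (hG : IsGK p G) (f : G ≃* G') : IsGK p G' := by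
  obtain ⟨h1, h2, M, hM, hMk⟩ := hG
  refine ⟨h1.of_equiv f, Finite.of_equiv _ f.toEquiv, M.map f.toMonoidHom, ?_, ?_⟩
  · exact (OrderIso.isCoatom_iff f.mapSubgroup M).2 hM
  · rw [Subgroup.coe_map, hMk, ← preimage_kernelSet f]
    exact Set.image_preimage_eq _ f.surjective

theorem nonempty_series_succ_equiv (f : kernel G ≃* H) (i : ℕ) :
    Nonempty (series G (i + 1) ≃* series H i) := by
  have aux : ∀ i, Nonempty (series G (i + 1) ≃* kernel (series G i)) := fun i =>
    ⟨((kernel (series G i)).equivMapOfInjective _ (Subgroup.subtype_injective _)).symm⟩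
  induction i with
  | zero =>
    obtain ⟨a⟩ := aux 0
    obtain ⟨b⟩ := nonempty_kernel_equiv (Subgroup.topEquiv : series G 0 ≃* G)
    exact ⟨a.trans (b.trans (f.trans Subgroup.topEquiv.symm))⟩
  | succ i ih =>
    obtain ⟨a⟩ := aux (i + 1)
    obtain ⟨g⟩ := ih
    obtain ⟨b⟩ := nonempty_kernel_equiv g
    exact ⟨a.trans (b.trans
      ((kernel (series H i)).equivMapOfInjective _ (Subgroup.subtype_injective _)))⟩

theorem hasRoot_zero {p : ℕ} {R : Type} [Group R] (hR : ¬ IsGK p R) (f : G ≃* R) :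
    HasRoot p G R 0 :=
  ⟨fun i hi => absurd hi (Nat.not_lt_zero i),
    fun h => hR (h.of_equiv ((Subgroup.topEquiv : series G 0 ≃* G).trans f)),
    ⟨(Subgroup.topEquiv : series G 0 ≃* G).trans f⟩⟩

theorem HasRoot.succ {p l : ℕ} {R : Type} [Group R] (hG : IsGK p G) (f : kernel G ≃* H)
    (h : HasRoot p H R l) : HasRoot p G R (l + 1) := by
  obtain ⟨h1, h2, ⟨h3⟩⟩ := h
  refine ⟨fun i hi => ?_, fun hl => ?_, ?_⟩
  · cases i with
    | zero => exact hG.of_equiv Subgroup.topEquiv.symm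
    | succ i =>
      obtain ⟨g⟩ := nonempty_series_succ_equiv f i
      exact (h1 i (by omega)).of_equiv g.symm
  · obtain ⟨g⟩ := nonempty_series_succ_equiv f l
    exact h2 (hl.of_equiv g)
  · obtain ⟨g⟩ := nonempty_series_succ_equiv f l
    exact ⟨g.trans h3⟩

/-! ### The embedding of the vertices of a path -/

/-- `ι` embeds `H` into `G` as the set of all elements whose order divides `exp(H)`, where
`exp(G) = p ^ t * exp(H)` and `|G| = p ^ t * |H|`. This is how the `t`-th member of the GK series
lies in a group of GK type of level at least `t`; in contrast to a mere chain of kernels the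
condition shows at once that the image is normal. -/
structure IsUp (p t : ℕ) (ι : H →* G) : Prop where
  inj : Function.Injective ι
  mem_range : ∀ g : G, g ^ Monoid.exponent H = 1 → g ∈ ι.range
  exponent_eq : Monoid.exponent G = p ^ t * Monoid.exponent H
  card_eq : Nat.card G = p ^ t * Nat.card H

namespace IsUp

theorem of_equiv (p : ℕ) (f : H ≃* G) : IsUp p 0 f.toMonoidHom where
  inj := f.injective
  mem_range g _ := ⟨f.symm g, by simp⟩
  exponent_eq := by rw [pow_zero, one_mul, Monoid.exponent_eq_of_mulEquiv f]
  card_eq := by rw [pow_zero, one_mul, Nat.card_congr f.toEquiv]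

theorem comp {p s t : ℕ} {ι : H →* G} {κ : G →* G'} (hκ : IsUp p s κ) (hι : IsUp p t ι) :
    IsUp p (t + s) (κ.comp ι) where
  inj := hκ.inj.comp hι.inj
  mem_range g hg := by
    obtain ⟨a, rfl⟩ := hκ.mem_range g (by rw [hι.exponent_eq, mul_comm, pow_mul, hg, one_pow])
    obtain ⟨b, rfl⟩ := hι.mem_range a
      (hκ.inj (by rw [map_pow, hg, map_one]))
    exact ⟨b, rfl⟩
  exponent_eq := by rw [hκ.exponent_eq, hι.exponent_eq, pow_add]; ring
  card_eq := by rw [hκ.card_eq, hι.card_eq, pow_add]; ring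

theorem mem_range_iff {p t : ℕ} {ι : H →* G} (h : IsUp p t ι) {g : G} :
    g ∈ ι.range ↔ g ^ Monoid.exponent H = 1 := by
  refine ⟨?_, h.mem_range g⟩
  rintro ⟨r, rfl⟩
  rw [← map_pow, Monoid.pow_exponent_eq_one, map_one]

theorem normal {p t : ℕ} {ι : H →* G} (h : IsUp p t ι) : ι.range.Normal where
  conj_mem n hn g := by
    rw [h.mem_range_iff] at hn ⊢
    rw [conj_pow, hn, mul_one, mul_inv_cancel]

end IsUp

theorem IsGK.exists_orderOf_eq {p : ℕ} (hG : IsGK p G) :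
    ∃ g : G, orderOf g = Monoid.exponent G := by
  obtain ⟨-, hfin, M, hM, hMk⟩ := hG
  obtain ⟨g, hg⟩ : ∃ g, g ∉ M := by
    by_contra! h
    exact hM.1 ((Subgroup.eq_top_iff' M).2 h)
  rw [← SetLike.mem_coe, hMk] at hg
  exact ⟨g, le_antisymm (Monoid.orderOf_le_exponent Monoid.ExponentExists.of_finite g)
    (not_lt.1 hg)⟩

/-- For `g` outside the kernel, `g ^ p` has order `exp(G) / p`; this determines the exponent of
the kernel. -/
theorem IsGK.isUp {p : ℕ} [hp : Fact p.Prime] (hG : IsGK p G) :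
    IsUp p 1 (kernel G).subtype := by
  obtain ⟨g, hg⟩ := hG.exists_orderOf_eq
  obtain ⟨hpG, hfin, M, hM, hMk⟩ := hG
  rw [kernel_eq_of_coe hMk]
  have hmem : ∀ x : G, x ∈ M ↔ orderOf x < Monoid.exponent G := fun x => by
    rw [← SetLike.mem_coe, hMk]; rfl
  obtain ⟨m, hm⟩ := IsPGroup.iff_orderOf.1 hpG g
  rw [hm] at hg
  have hm0 : m ≠ 0 := by
    rintro rfl
    have := (hmem 1).1 M.one_mem
    rw [← hg] at this
    simp at this
  obtain ⟨k, rfl⟩ := Nat.exists_eq_succ_of_ne_zero hm0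
  have hgp : orderOf (g ^ p) = p ^ k := by
    rw [orderOf_pow_of_dvd hp.1.ne_zero (by rw [hm]; exact dvd_pow_self _ hm0), hm, pow_succ,
      Nat.mul_div_cancel _ hp.1.pos]
  have hgM : g ^ p ∈ M := by
    rw [hmem, hgp, ← hg]
    exact Nat.pow_lt_pow_right hp.1.one_lt (Nat.lt_succ_self k)
  have hMdvd : ∀ x ∈ M, x ^ p ^ k = 1 := fun x hx => by
    rw [hmem] at hx
    obtain ⟨j, hj⟩ := IsPGroup.iff_orderOf.1 hpG x
    rw [hj, ← hg] at hx
    rw [← orderOf_dvd_iff_pow_eq_one, hj]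
    exact pow_dvd_pow _ (Nat.lt_succ_iff.1 ((Nat.pow_lt_pow_iff_right hp.1.one_lt).1 hx))
  have hexp : Monoid.exponent M = p ^ k := by
    refine Nat.dvd_antisymm (Monoid.exponent_dvd_of_forall_pow_eq_one fun x => ?_) ?_
    · exact Subtype.ext (hMdvd x x.2)
    · rw [← hgp, ← Subgroup.orderOf_mk _ hgM]
      exact Monoid.order_dvd_exponent _
  refine ⟨Subgroup.subtype_injective M, fun x hx => ?_, ?_, ?_⟩
  · rw [Subgroup.range_subtype, hmem, ← hg]
    rw [hexp] at hx
    exact (Nat.le_of_dvd (pow_pos hp.1.pos k) (orderOf_dvd_of_pow_eq_one hx)).trans_lt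
      (Nat.pow_lt_pow_right hp.1.one_lt (Nat.lt_succ_self k))
  · rw [hexp, ← hg, pow_one, pow_succ, mul_comm]
  · -- a maximal subgroup of a finite `p`-group has index `p`
    obtain ⟨N, hN⟩ := IsPGroup.iff_card.1 hpG
    obtain ⟨n, hn⟩ := IsPGroup.iff_card.1 (hpG.to_subgroup M)
    have hlt : Nat.card M < Nat.card G := by
      refine lt_of_le_of_ne (Subgroup.card_le_card_group M) fun h => hM.1 ?_
      exact Subgroup.eq_top_of_card_eq M h
    rw [hn, hN] at hlt
    have hnN := (Nat.pow_lt_pow_iff_right hp.1.one_lt).1 hlt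
    obtain ⟨K, hK, hMK⟩ := Sylow.exists_subgroup_card_pow_prime_le (m := n + 1) (p := p)
      (by rw [hN]; exact pow_dvd_pow _ hnN) M hn (Nat.le_succ n)
    have hKM : K ≠ M := by
      rintro rfl
      rw [hn] at hK
      exact absurd (Nat.pow_right_injective hp.1.two_le hK) (by omega)
    have hKt := hM.2 K (lt_of_le_of_ne hMK hKM.symm)
    rw [hKt] at hK
    rw [← Subgroup.card_top, hK, hn, pow_one, pow_succ, mul_comm]

/-! ### The vertices of a stem -/

theorem exists_isoType_eq (c : IsoType) :
    ∃ (G : Type) (_ : Group G) (_ : Finite G), c = isoType G := by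
  obtain ⟨G, rfl⟩ := Quotient.exists_rep c
  exact ⟨G, inferInstance, inferInstance, rfl⟩

section
variable {p : ℕ} {R : Type} [Group R] [Finite R]

theorem Stem.isGK (s : Stem p R) {l : ℕ} [Finite G] (hG : (s.at (l + 1) : IsoType) = isoType G) :
    IsGK p G := by
  obtain ⟨G1, _, _, h1, h2, -⟩ := s.2.2 l
  obtain ⟨f⟩ := isoType_eq_iff.1 (h1.symm.trans hG)
  exact h2.of_equiv f

variable [hp : Fact p.Prime]

/-- Any vertex of a stem embeds into the vertex lying `t` levels above it. -/
theorem Stem.exists_isUp (s : Stem p R) {l : ℕ} [Finite H]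
    (hH : (s.at l : IsoType) = isoType H) (t : ℕ) [Finite G]
    (hG : (s.at (l + t) : IsoType) = isoType G) : ∃ ι : H →* G, IsUp p t ι := by
  induction t generalizing G with
  | zero =>
    obtain ⟨f⟩ := isoType_eq_iff.1 (hH.symm.trans hG)
    exact ⟨_, .of_equiv p f⟩
  | succ t ih =>
    obtain ⟨G1, _, _, h1, h2, h3⟩ := s.2.2 (l + t)
    obtain ⟨f⟩ := isoType_eq_iff.1 (h1.symm.trans hG)
    obtain ⟨ι, hι⟩ := ih h3
    exact ⟨_, (IsUp.of_equiv p f).comp (h2.isUp.comp hι)⟩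

/-- If `g` has maximal order in a vertex `G` lying `t` levels above `H` on a stem, then `g ^ p ^ t`
lies in `H`. Conjugation by `g` induces on `H` an automorphism of `p`-power order, which is killed
by `p ^ t` when `t` is large; as a stem is infinite, `H` has a central element of maximal order. -/
theorem Stem.exists_central (s : Stem p R) {l : ℕ} [Finite H]
    (hH : (s.at l : IsoType) = isoType H) :
    ∃ c : H, (∀ g, Commute c g) ∧ orderOf c = Monoid.exponent H := by
  have : Finite (MulAut H) := Finite.of_injective (fun f : MulAut H => (f : H → H))
    DFunLike.coe_injective
  set t := Nat.card (MulAut H) with ht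
  have ht0 : 0 < t := Nat.card_pos
  obtain ⟨G, _, _, hG⟩ := exists_isoType_eq (s.at (l + t) : IsoType)
  have hGK : IsGK p G := by
    obtain ⟨k, hk⟩ := Nat.exists_eq_succ_of_ne_zero (show l + t ≠ 0 by omega)
    rw [hk] at hG
    exact s.isGK hG
  obtain ⟨ι, hι⟩ := s.exists_isUp hH t hG
  obtain ⟨g, hg⟩ := hGK.exists_orderOf_eq
  obtain ⟨c, hc⟩ := hι.mem_range (g ^ p ^ t) (by
    rw [← pow_mul, ← hι.exponent_eq, Monoid.pow_exponent_eq_one])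
  have := hι.normal
  -- `t` was chosen before `G` and `ι`, hence as `|Aut(H)|` instead of the order of this group
  have hcard : Nat.card (MulAut ι.range) = t := by
    rw [ht]
    exact (Nat.card_congr (MulAut.congr (MonoidHom.ofInjective hι.inj)).toEquiv).symm
  have hfin : Finite (MulAut ι.range) := Nat.finite_of_card_ne_zero (by omega)
  obtain ⟨k, hk⟩ := hGK.1 g
  have hk' : orderOf (MulAut.conjNormal (H := ι.range) g) ∣ p ^ k := by
    rw [orderOf_dvd_iff_pow_eq_one, ← map_pow, hk, map_one]
  obtain ⟨j, -, hj⟩ := (Nat.dvd_prime_pow hp.1).1 hk'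
  -- `p ^ j ≤ |Aut(H)| = t < p ^ t`
  have hjt : j ≤ t := by
    have h1 : p ^ j ≤ t := by
      rw [← hj, ← hcard]; exact Nat.le_of_dvd Nat.card_pos (orderOf_dvd_natCard _)
    exact (Nat.lt_pow_self hp.1.one_lt).le.trans h1
  have h1 : MulAut.conjNormal (H := ι.range) (g ^ p ^ t) = 1 := by
    rw [map_pow, ← orderOf_dvd_iff_pow_eq_one, hj]
    exact pow_dvd_pow _ hjt
  refine ⟨c, fun r => hι.inj ?_, ?_⟩
  · have h2 := congrArg Subtype.val (DFunLike.congr_fun h1 ⟨ι r, r, rfl⟩)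
    rw [MulAut.conjNormal_apply, ← hc, MulAut.one_apply] at h2
    rw [map_mul, map_mul]
    exact mul_inv_eq_iff_eq_mul.1 h2
  · rw [← orderOf_injective ι hι.inj, hc, orderOf_pow_of_dvd (pow_ne_zero _ hp.1.ne_zero)
      (by rw [hg, hι.exponent_eq]; exact Dvd.intro _ rfl), hg, hι.exponent_eq,
      Nat.mul_div_cancel_left _ (pow_pos hp.1.pos t)]

/-- Every vertex of a stem is a trivial cyclic extension of the root. -/
theorem Stem.exists_isTrivExt (s : Stem p R) {l : ℕ} [Finite G]
    (hG : (s.at l : IsoType) = isoType G) :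
    ∃ (h : R) (c : G) (ι : R →* G), h ∈ maxCentral R ∧ IsTrivExt (p ^ l) h c ι := by
  obtain ⟨c, hc, ho⟩ := s.exists_central hG
  have h0 : (s.at 0 : IsoType) = isoType R := by rw [Stem.at, s.2.1]; rfl
  rw [← Nat.zero_add l] at hG
  obtain ⟨ι, hι⟩ := s.exists_isUp h0 l hG
  obtain ⟨h, hh⟩ := hι.mem_range (c ^ p ^ l) (by
    rw [← pow_mul, ← hι.exponent_eq, Monoid.pow_exponent_eq_one])
  have hR0 : Monoid.exponent R ≠ 0 := Monoid.exponent_ne_zero_of_finite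
  refine ⟨h, c, ι, ⟨?_, ?_⟩, IsTrivExt.of_card hι.inj hc hh.symm (fun i hi => ?_) hι.card_eq⟩
  · refine Subgroup.mem_center_iff.2 fun r => hι.inj ?_
    rw [map_mul, map_mul, hh]
    exact ((hc (ι r)).pow_left _).symm
  · rw [← orderOf_injective ι hι.inj, hh, orderOf_pow_of_dvd (pow_ne_zero _ hp.1.ne_zero)
      (by rw [ho, hι.exponent_eq]; exact Dvd.intro _ rfl), ho, hι.exponent_eq,
      Nat.mul_div_cancel_left _ (pow_pos hp.1.pos l)]
  · rw [hι.mem_range_iff, ← zpow_natCast, ← zpow_mul, ← orderOf_dvd_iff_zpow_eq_one, ho,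
      hι.exponent_eq, Nat.cast_mul] at hi
    exact Int.dvd_of_mul_dvd_mul_right (Nat.cast_ne_zero.2 hR0) hi

end

end

section

variable {H G G' : Type} [Group H] [Group G] [Group G']

/-! ### Trivial cyclic extensions of `p`-power degree -/

/-- `h'` arises from `h` by one of the maps `h ↦ (h ^ α) ^ k * y` of which `A_l(H)` consists
when `l ≥ 1`. -/
def PermRel (p l : ℕ) (h h' : H) : Prop :=
  ∃ (α : MulAut H) (k : ℕ) (y : powSubgroup (Subgroup.center H) (p ^ l)),
    Nat.Coprime k (Monoid.exponent H) ∧ h' = α h ^ k * ((y : Subgroup.center H) : H)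

theorem exists_pow_eq_of_mem_powSubgroup_center {n : ℕ}
    (y : powSubgroup (Subgroup.center H) n) :
    ∃ r ∈ Subgroup.center H, ((y : Subgroup.center H) : H) = r ^ n := by
  obtain ⟨y, hy⟩ := y
  induction hy using Subgroup.closure_induction with
  | mem y hy =>
    obtain ⟨r, rfl⟩ := hy
    exact ⟨r, r.2, rfl⟩
  | one => exact ⟨1, one_mem _, (one_pow n).symm⟩
  | mul a b _ _ ha hb =>
    obtain ⟨r, hr, har⟩ := ha
    obtain ⟨s, hs, hbs⟩ := hb
    refine ⟨r * s, mul_mem hr hs, ?_⟩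
    rw [Commute.mul_pow (Subgroup.mem_center_iff.1 hs r)]
    simp only at har hbs
    rw [← har, ← hbs]; rfl
  | inv a _ ha =>
    obtain ⟨r, hr, har⟩ := ha
    refine ⟨r⁻¹, inv_mem hr, ?_⟩
    simp only at har
    rw [inv_pow, ← har]; rfl

theorem exists_powSubgroup_center_eq {r : H} (hr : r ∈ Subgroup.center H) (n : ℕ) :
    ∃ y : powSubgroup (Subgroup.center H) n, ((y : Subgroup.center H) : H) = r ^ n :=
  ⟨⟨⟨r, hr⟩ ^ n, Subgroup.subset_closure ⟨_, rfl⟩⟩, rfl⟩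

section
variable {p e l : ℕ} {h : H} {c : G} {ι : H →* G}

namespace IsTrivExt

theorem dvd_of_zpow_eq_one (T : IsTrivExt (p ^ l) h c ι) (ho : orderOf h = p ^ e) {j : ℤ}
    (hj : c ^ j = 1) : ((p ^ (l + e) : ℕ) : ℤ) ∣ j := by
  obtain ⟨m, rfl⟩ := T.dvd j (by rw [hj]; exact one_mem _)
  rw [zpow_mul, zpow_natCast, T.pow_eq, ← map_zpow, ← map_one ι] at hj
  have := orderOf_dvd_iff_zpow_eq_one.2 (T.inj hj)
  rw [pow_add, Nat.cast_mul]
  rw [ho] at this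
  exact mul_dvd_mul_left _ this

theorem zpow_eq_one (T : IsTrivExt (p ^ l) h c ι) (ho : orderOf h = p ^ e) {j : ℤ}
    (hj : ((p ^ (l + e) : ℕ) : ℤ) ∣ j) : c ^ j = 1 := by
  obtain ⟨m, rfl⟩ := hj
  rw [zpow_mul, zpow_natCast, pow_add, pow_mul, T.pow_eq, ← map_pow, ← ho, pow_orderOf_eq_one,
    map_one, one_zpow]

theorem pow_eq_one (T : IsTrivExt (p ^ l) h c ι) (hexp : Monoid.exponent H = p ^ e)
    (ho : orderOf h = p ^ e) (g : G) : g ^ p ^ (l + e) = 1 := by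
  obtain ⟨i, r, rfl⟩ := T.gen g
  rw [T.pow_mul_map, T.zpow_eq_one ho (Dvd.intro_left _ rfl), pow_add, mul_comm, pow_mul, ← hexp,
    Monoid.pow_exponent_eq_one, one_pow, map_one, mul_one]

end IsTrivExt

variable [hp : Fact p.Prime]

theorem coprime_exponent_iff (he : 1 ≤ e) (hexp : Monoid.exponent H = p ^ e) (k : ℕ) :
    Nat.Coprime k (Monoid.exponent H) ↔ ¬ p ∣ k := by
  rw [hexp, Nat.coprime_pow_right_iff he, Nat.coprime_comm, hp.1.coprime_iff_not_dvd]

namespace IsTrivExt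

/-- The elements outside the extension of `H` by `⟨c ^ p⟩` are those of maximal order. The `r`-part
vanishes in the power because `l ≥ 1`. -/
theorem pow_eq_one_iff (T : IsTrivExt (p ^ l) h c ι) (he : 1 ≤ e) (hl : 1 ≤ l)
    (hexp : Monoid.exponent H = p ^ e) (ho : orderOf h = p ^ e) (i : ℤ) (r : H) :
    (c ^ i * ι r) ^ p ^ (l + e - 1) = 1 ↔ (p : ℤ) ∣ i := by
  have hr : r ^ p ^ (l + e - 1) = 1 := by
    rw [← orderOf_dvd_iff_pow_eq_one]
    refine (Monoid.order_dvd_exponent r).trans ?_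
    rw [hexp]
    exact pow_dvd_pow _ (by omega)
  have hle : p ^ (l + e) = p * p ^ (l + e - 1) := by
    rw [← pow_succ']; congr 1; omega
  rw [T.pow_mul_map, hr, map_one, mul_one]
  constructor
  · intro hi
    have := T.dvd_of_zpow_eq_one ho hi
    rw [hle, Nat.cast_mul] at this
    exact Int.dvd_of_mul_dvd_mul_right (Nat.cast_ne_zero.2 (pow_ne_zero _ hp.1.ne_zero)) this
  · intro hi
    refine T.zpow_eq_one ho ?_
    rw [hle, Nat.cast_mul]
    exact mul_dvd_mul_right hi _

theorem exponent_eq (T : IsTrivExt (p ^ l) h c ι) (he : 1 ≤ e) (hl : 1 ≤ l)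
    (hexp : Monoid.exponent H = p ^ e) (ho : orderOf h = p ^ e) :
    Monoid.exponent G = p ^ (l + e) := by
  refine Nat.dvd_antisymm (Monoid.exponent_dvd_of_forall_pow_eq_one (T.pow_eq_one hexp ho)) ?_
  have h1 : orderOf c = p ^ (l + e - 1 + 1) := by
    refine orderOf_eq_prime_pow (fun h => ?_) ?_
    · have := (T.pow_eq_one_iff he hl hexp ho 1 1).1 (by simpa using h)
      exact hp.1.one_lt.ne' (by exact_mod_cast Int.eq_one_of_dvd_one (by positivity) this)
    · rw [show l + e - 1 + 1 = l + e by omega]; exact T.pow_eq_one hexp ho c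
  rw [show l + e = l + e - 1 + 1 by omega, ← h1]
  exact Monoid.order_dvd_exponent c

theorem mem_kernelSet_iff (T : IsTrivExt (p ^ l) h c ι) (he : 1 ≤ e) (hl : 1 ≤ l)
    (hexp : Monoid.exponent H = p ^ e) (ho : orderOf h = p ^ e) (i : ℤ) (r : H) :
    c ^ i * ι r ∈ kernelSet G ↔ (p : ℤ) ∣ i := by
  rw [← T.pow_eq_one_iff he hl hexp ho i r, kernelSet, Set.mem_ofPred_eq,
    T.exponent_eq he hl hexp ho]
  have h1 := T.pow_eq_one hexp ho (c ^ i * ι r)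
  rw [← orderOf_dvd_iff_pow_eq_one] at h1
  obtain ⟨j, hj, hj'⟩ := (Nat.dvd_prime_pow hp.1).1 h1
  rw [← orderOf_dvd_iff_pow_eq_one, hj', Nat.pow_dvd_pow_iff_le_right hp.1.one_lt,
    Nat.pow_lt_pow_iff_right hp.1.one_lt]
  omega

theorem mem_range_iff (T : IsTrivExt (p ^ l) h c ι) (hexp : Monoid.exponent H = p ^ e)
    (ho : orderOf h = p ^ e) {g : G} : g ∈ ι.range ↔ g ^ p ^ e = 1 := by
  constructor
  · rintro ⟨r, rfl⟩
    rw [← map_pow, ← hexp, Monoid.pow_exponent_eq_one, map_one]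
  · intro hg
    obtain ⟨i, r, rfl⟩ := T.gen g
    rw [T.pow_mul_map, ← hexp, Monoid.pow_exponent_eq_one, map_one, mul_one, hexp] at hg
    have := T.dvd_of_zpow_eq_one ho hg
    rw [pow_add, Nat.cast_mul] at this
    obtain ⟨j, rfl⟩ := Int.dvd_of_mul_dvd_mul_right
      (Nat.cast_ne_zero.2 (pow_ne_zero _ hp.1.ne_zero)) this
    refine ⟨h ^ j * r, ?_⟩
    rw [map_mul, map_zpow, ← T.pow_eq, zpow_mul, zpow_natCast]

/-- The image of `H` consists of the elements of order dividing `exp(H)`, so it does not depend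
on how a group is written as a trivial cyclic extension of `H`. -/
theorem permRel {h' : H} {c' : G} {ι' : H →* G} (T : IsTrivExt (p ^ l) h c ι)
    (T' : IsTrivExt (p ^ l) h' c' ι') (he : 1 ≤ e) (hl : 1 ≤ l)
    (hexp : Monoid.exponent H = p ^ e) (ho : orderOf h = p ^ e) (ho' : orderOf h' = p ^ e) :
    PermRel p l h h' := by
  have hrange : ι.range = ι'.range := by
    ext g; rw [T.mem_range_iff hexp ho, T'.mem_range_iff hexp ho']
  let α : MulAut H := (MonoidHom.ofInjective T.inj).trans
    ((MulEquiv.subgroupCongr hrange).trans (MonoidHom.ofInjective T'.inj).symm)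
  have hα : ∀ r, ι' (α r) = ι r := fun r =>
    congrArg Subtype.val ((MonoidHom.ofInjective T'.inj).apply_symm_apply
      (MulEquiv.subgroupCongr hrange (MonoidHom.ofInjective T.inj r)))
  obtain ⟨k, r, hkr⟩ := T.gen c'
  -- `c'` has maximal order
  have hk : ¬ (p : ℤ) ∣ k := by
    rw [← T.pow_eq_one_iff he hl hexp ho k r, ← hkr]
    have := (T'.pow_eq_one_iff he hl hexp ho' 1 1).not
    rw [zpow_one, map_one, mul_one] at this
    rw [this]
    exact fun h => hp.1.one_lt.ne' (by exact_mod_cast Int.eq_one_of_dvd_one (by positivity) h)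
  have hr : ∀ s, Commute r s := by
    intro s
    have h1 : ι r = (c ^ k)⁻¹ * c' := by rw [hkr, inv_mul_cancel_left]
    have h2 : Commute (ι r) (ι s) := by
      rw [h1]
      exact ((T.comm _).zpow_left k).inv_left.mul_left (T'.comm _)
    exact T.inj (by rw [map_mul, map_mul, h2.eq])
  have hαr : α r ∈ Subgroup.center H := by
    refine Subgroup.mem_center_iff.2 fun s => ?_
    have := (hr (α.symm s)).map α
    rw [MulEquiv.apply_symm_apply] at this
    exact this.eq.symm
  have hpe : (0 : ℤ) < (p ^ e : ℕ) := by exact_mod_cast pow_pos hp.1.pos e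
  obtain ⟨y, hy⟩ := exists_powSubgroup_center_eq hαr (p ^ l)
  refine ⟨α, (k % (p ^ e : ℕ)).toNat, y, ?_, ?_⟩
  · rw [coprime_exponent_iff he hexp, ← Int.natCast_dvd_natCast,
      Int.toNat_of_nonneg (Int.emod_nonneg _ hpe.ne')]
    intro h
    have h0 : (p : ℤ) ∣ (p ^ e : ℕ) := by exact_mod_cast dvd_pow_self p (by omega)
    rw [← Int.emod_add_mul_ediv k (p ^ e : ℕ)] at hk
    exact hk (dvd_add h (h0.mul_right _))
  · apply T'.inj
    have h1 : α h ^ (k % (p ^ e : ℕ)).toNat = α h ^ k := by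
      rw [← zpow_natCast, Int.toNat_of_nonneg (Int.emod_nonneg _ hpe.ne'), ← ho,
        ← MulEquiv.orderOf_eq α h, zpow_mod_orderOf]
    rw [← T'.pow_eq, hkr, T.pow_mul_map, h1, hy]
    simp only [map_mul, map_zpow, map_pow, hα]
    rw [mul_comm, zpow_mul, zpow_natCast, T.pow_eq]

variable [Finite G]

/-- The extension of degree `p ^ (l + 1)` is of GK type, with kernel generated by `c ^ p` and the
image of `H`. -/
theorem isGK_and_kernel (T : IsTrivExt (p ^ (l + 1)) h c ι) (he : 1 ≤ e)
    (hexp : Monoid.exponent H = p ^ e) (ho : orderOf h = p ^ e) :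
    IsGK p G ∧ ∃ (c' : kernel G) (ι' : H →* kernel G), IsTrivExt (p ^ l) h c' ι' := by
  have key := T.mem_kernelSet_iff he (by omega) hexp ho
  let M : Subgroup G :=
    { carrier := kernelSet G
      one_mem' := by
        have := (key 0 1).2 (dvd_zero _)
        simpa using this
      mul_mem' := by
        intro a b ha hb
        obtain ⟨i, r, rfl⟩ := T.gen a
        obtain ⟨j, s, rfl⟩ := T.gen b
        rw [key] at ha hb
        have : c ^ i * ι r * (c ^ j * ι s) = c ^ (i + j) * ι (r * s) := by
          rw [zpow_add, map_mul, mul_assoc, mul_assoc, ← mul_assoc (ι r),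
            ← ((T.comm (ι r)).zpow_left j).eq, mul_assoc]
        rw [this, key]
        exact dvd_add ha hb
      inv_mem' := by
        intro a ha
        have : orderOf a⁻¹ < Monoid.exponent G := by rw [orderOf_inv]; exact ha
        exact this }
  have hM : ∀ (i : ℤ) (r : H), c ^ i * ι r ∈ M ↔ (p : ℤ) ∣ i := key
  have hι : ∀ r, ι r ∈ M := fun r => by
    have := (hM 0 r).2 (dvd_zero _)
    simpa using this
  have hc : ∀ i : ℤ, c ^ i ∈ M ↔ (p : ℤ) ∣ i := fun i => by
    have := hM i 1
    simpa using this
  refine ⟨⟨fun g => ⟨_, T.pow_eq_one hexp ho g⟩, inferInstance, M, ⟨fun h => ?_, fun N hN => ?_⟩,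
    rfl⟩, ?_⟩
  · have := (hc 1).1 (h ▸ Subgroup.mem_top _)
    exact hp.1.one_lt.ne' (by exact_mod_cast Int.eq_one_of_dvd_one (by positivity) this)
  · obtain ⟨hle, g, hgN, hgM⟩ := SetLike.lt_iff_le_and_exists.1 hN
    obtain ⟨i, r, rfl⟩ := T.gen g
    rw [hM] at hgM
    have h1 : c ^ i ∈ N := (Subgroup.mul_mem_cancel_right N (hle (hι r))).1 hgN
    have h2 : c ^ (p : ℤ) ∈ N := hle ((hc p).2 dvd_rfl)
    -- a Bézout combination of `p` and `i` recovers `c`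
    obtain ⟨a, b, hab⟩ := ((Nat.prime_iff_prime_int.1 hp.1).coprime_iff_not_dvd).2 hgM
    have h3 : c ∈ N := by
      have : c = (c ^ (p : ℤ)) ^ a * (c ^ i) ^ b := by
        rw [← zpow_mul, ← zpow_mul, ← zpow_add, mul_comm _ a, mul_comm i, hab, zpow_one]
      rw [this]
      exact N.mul_mem (N.zpow_mem h2 _) (N.zpow_mem h1 _)
    refine (Subgroup.eq_top_iff' N).2 fun x => ?_
    obtain ⟨i, r, rfl⟩ := T.gen x
    exact N.mul_mem (N.zpow_mem h3 _) (hle (hι r))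
  · rw [kernel_eq_of_coe (M := M) rfl]
    have hcp : c ^ p ∈ M := by
      have := (hc p).2 dvd_rfl
      rwa [zpow_natCast] at this
    refine ⟨⟨c ^ p, hcp⟩, ι.codRestrict M hι, ?_, ?_, ?_, ?_, ?_⟩
    · exact fun a b hab => T.inj (congrArg Subtype.val hab)
    · exact fun g => Subtype.ext ((T.comm g).pow_left p)
    · refine Subtype.ext ?_
      simp only [SubmonoidClass.mk_pow, MonoidHom.codRestrict_apply]
      rw [← pow_mul, ← pow_succ', T.pow_eq]
    · rintro i ⟨r, hr⟩
      have h1 : ι r = c ^ ((p : ℤ) * i) := by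
        rw [zpow_mul, zpow_natCast]; exact congrArg Subtype.val hr
      have h2 := T.dvd _ ⟨r, h1⟩
      rw [pow_succ', Nat.cast_mul] at h2
      exact Int.dvd_of_mul_dvd_mul_left (Nat.cast_ne_zero.2 hp.1.ne_zero) h2
    · rintro ⟨g, hg⟩
      obtain ⟨i, r, rfl⟩ := T.gen g
      obtain ⟨j, rfl⟩ := (hM i r).1 hg
      refine ⟨j, r, Subtype.ext ?_⟩
      simp [zpow_mul]

/-- If `h' = α h ^ k * r ^ p ^ l`, then `c ^ k * ι (α⁻¹ r)` and `ι ∘ α⁻¹` exhibit `G` as an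
extension belonging to `h'`. -/
theorem exists_of_permRel (T : IsTrivExt (p ^ l) h c ι) (he : 1 ≤ e)
    (hexp : Monoid.exponent H = p ^ e) {h' : H} (hrel : PermRel p l h h') :
    ∃ (c' : G) (ι' : H →* G), IsTrivExt (p ^ l) h' c' ι' := by
  obtain ⟨α, k, y, hk, rfl⟩ := hrel
  rw [coprime_exponent_iff he hexp] at hk
  obtain ⟨r, hr, hry⟩ := exists_pow_eq_of_mem_powSubgroup_center y
  have hr' : ∀ g, Commute (ι (α.symm r)) g := by
    intro g
    obtain ⟨i, s, rfl⟩ := T.gen g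
    refine Commute.mul_right ((T.comm _).symm.zpow_right i) (Commute.map ?_ ι)
    have : Commute r (α s) := (Subgroup.mem_center_iff.1 hr (α s)).symm
    simpa using this.map α.symm
  refine ⟨c ^ k * ι (α.symm r), ι.comp α.symm.toMonoidHom,
    of_card (T.inj.comp α.symm.injective) (fun g => ((T.comm g).pow_left k).mul_left (hr' g)) ?_ ?_
      (T.card_eq (pow_ne_zero _ hp.1.ne_zero))⟩
  · have := T.pow_mul_map k (α.symm r) (p ^ l)
    rw [zpow_natCast] at this
    rw [this, hry, mul_comm, zpow_mul, zpow_natCast, zpow_natCast, T.pow_eq]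
    simp
  · rintro i ⟨s, hs⟩
    have h1 : c ^ ((k : ℤ) * i) = ι (α.symm s * (α.symm r ^ i)⁻¹) := by
      rw [map_mul, map_inv, map_zpow, eq_mul_inv_iff_mul_eq, zpow_mul, zpow_natCast,
        ← ((T.comm _).pow_left k).mul_zpow]
      exact hs.symm
    have h2 := T.dvd _ ⟨_, h1.symm⟩
    refine IsCoprime.dvd_of_dvd_mul_left ?_ h2
    rw [Nat.isCoprime_iff_coprime]
    exact Nat.Coprime.pow_left _ ((hp.1.coprime_iff_not_dvd).2 hk)

end IsTrivExt

/-- Two trivial cyclic extensions of degree `p ^ l > 1` are isomorphic if and only if they belong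
to elements in the same orbit. -/
theorem nonempty_trivExt_equiv_iff [Finite H] (he : 1 ≤ e) (hl : 1 ≤ l)
    (hexp : Monoid.exponent H = p ^ e) {h h' : Subgroup.center H}
    (ho : orderOf (h : H) = p ^ e) (ho' : orderOf (h' : H) = p ^ e) :
    Nonempty (TrivExt (p ^ l) h ≃* TrivExt (p ^ l) h') ↔ PermRel p l (h : H) (h' : H) := by
  have hpl : p ^ l ≠ 0 := pow_ne_zero _ hp.1.ne_zero
  obtain ⟨c, ι, T⟩ := IsTrivExt.exists_trivExt hpl h
  obtain ⟨c', ι', T'⟩ := IsTrivExt.exists_trivExt hpl h'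
  constructor
  · rintro ⟨f⟩
    exact (T.map_equiv f).permRel T' he hl hexp ho ho'
  · intro hrel
    obtain ⟨_, _, T1⟩ := T.exists_of_permRel he hexp hrel
    obtain ⟨f⟩ := T1.nonempty_equiv (h := h')
    exact ⟨f.symm⟩

end

end

section

/-! ### Orbits of `A_l(H)` -/

section
variable {H : Type} [Group H]

/-- The characteristic subgroup `H ^ m * H'`. -/
def powCommutator (H : Type) [Group H] (m : ℕ) : Subgroup H := powSubgroup H m ⊔ commutator H

theorem mulAut_mem_powCommutator_iff (m : ℕ) (α : MulAut H) {g : H} :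
    α g ∈ powCommutator H m ↔ g ∈ powCommutator H m := by
  have aux : ∀ (α : MulAut H) {g : H}, g ∈ powCommutator H m → α g ∈ powCommutator H m := by
    intro α g hg
    have : powCommutator H m ≤ (powCommutator H m).comap α.toMonoidHom := by
      refine sup_le ((Subgroup.closure_le _).2 ?_) ?_
      · rintro _ ⟨r, rfl⟩
        refine Subgroup.mem_sup_left (Subgroup.subset_closure ⟨α r, ?_⟩)
        simp
      · have hc := Subgroup.Characteristic.fixed (H := commutator H) (self := inferInstance) α
        rw [← Subgroup.map_le_iff_le_comap]
        refine le_trans (Subgroup.map_le_iff_le_comap.2 hc.ge) le_sup_right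
    exact this hg
  refine ⟨fun h => ?_, aux α⟩
  have := aux α⁻¹ h
  simpa using this

/-- The factor from `Z(H) ^ p ^ l` lies in `H ^ p ^ b`, and a power map prime to the exponent can
be inverted by a power map. -/
theorem PermRel.mem_powCommutator_iff {p l : ℕ} {h h' : H} (hrel : PermRel p l h h') {b : ℕ}
    (hb : b ≤ l) : h' ∈ powCommutator H (p ^ b) ↔ h ∈ powCommutator H (p ^ b) := by
  obtain ⟨α, k, y, hk, rfl⟩ := hrel
  obtain ⟨r, hr, hy⟩ := exists_pow_eq_of_mem_powSubgroup_center y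
  have h1 : ((y : Subgroup.center H) : H) ∈ powCommutator H (p ^ b) := by
    refine Subgroup.mem_sup_left (Subgroup.subset_closure ⟨r ^ p ^ (l - b), ?_⟩)
    simp only
    rw [hy, ← pow_mul, ← pow_add, Nat.sub_add_cancel hb]
  rw [Subgroup.mul_mem_cancel_right _ h1, ← mulAut_mem_powCommutator_iff _ α (g := h)]
  refine ⟨fun h2 => ?_, fun h2 => pow_mem h2 k⟩
  obtain ⟨m, hm⟩ := exists_pow_eq_self_of_coprime (x := α h)
    (hk.coprime_dvd_right (Monoid.order_dvd_exponent _))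
  rw [← hm]
  exact pow_mem h2 m

theorem mem_maxCentral_iff {p e : ℕ} [hp : Fact p.Prime] (he : 1 ≤ e)
    (hexp : Monoid.exponent H = p ^ e) {h : H} :
    h ∈ maxCentral H ↔ h ∈ Subgroup.center H ∧ h ^ p ^ (e - 1) ≠ 1 := by
  refine and_congr_right fun _ => ?_
  rw [hexp]
  obtain ⟨e, rfl⟩ := Nat.exists_eq_succ_of_ne_zero (show e ≠ 0 by omega)
  rw [Nat.succ_sub_one]
  constructor
  · intro ho h1
    rw [← orderOf_dvd_iff_pow_eq_one, ho, Nat.pow_dvd_pow_iff_le_right hp.1.one_lt] at h1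
    omega
  · intro h1
    refine orderOf_eq_prime_pow h1 ?_
    rw [← Nat.succ_eq_add_one, ← hexp, Monoid.pow_exponent_eq_one]

/-- For `l ≥ 1` the relation `PermRel` is realised by permutations in `A_l(H)`. -/
theorem PermRel.exists_perm {p e l : ℕ} [hp : Fact p.Prime] [Finite H] (he : 1 ≤ e) (hl : 1 ≤ l)
    (hexp : Monoid.exponent H = p ^ e) {h : maxCentral H} {h' : H}
    (hrel : PermRel p l (h : H) h') : ∃ σ ∈ permGroup p H l, (σ h : H) = h' := by
  obtain ⟨α, k, y, hk, rfl⟩ := hrel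
  obtain ⟨r, hr, hy⟩ := exists_pow_eq_of_mem_powSubgroup_center y
  have hkp := (coprime_exponent_iff he hexp k).1 hk
  have hmem : ∀ g : maxCentral H, α g ^ k * ((y : Subgroup.center H) : H) ∈ maxCentral H := by
    rintro ⟨g, hg⟩
    rw [mem_maxCentral_iff he hexp] at hg ⊢
    have h1 : α g ∈ Subgroup.center H := by
      rw [Subgroup.mem_center_iff] at hg ⊢
      intro s
      have := congrArg α (hg.1 (α.symm s))
      simpa using this
    refine ⟨mul_mem (pow_mem h1 k) y.1.2, ?_⟩
    rw [Commute.mul_pow (Subgroup.mem_center_iff.1 y.1.2 _), hy, ← pow_mul r, ← pow_add,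
      show r ^ p ^ (l + (e - 1)) = 1 from ?_, mul_one]
    · intro h2
      apply hg.2
      apply α.injective
      rw [map_pow, map_one]
      have h3 : (α g ^ p ^ (e - 1)) ^ k = 1 := by rw [← pow_mul, mul_comm, pow_mul, h2]
      have h4 : (α g ^ p ^ (e - 1)) ^ p ^ e = 1 := by rw [← hexp, Monoid.pow_exponent_eq_one]
      have h5 := Nat.dvd_gcd (orderOf_dvd_of_pow_eq_one h3) (orderOf_dvd_of_pow_eq_one h4)
      rw [← hexp, hk.gcd_eq_one] at h5
      exact orderOf_eq_one_iff.1 (Nat.dvd_one.1 h5)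
    · rw [← orderOf_dvd_iff_pow_eq_one]
      refine (Monoid.order_dvd_exponent r).trans ?_
      rw [hexp]
      exact pow_dvd_pow _ (by omega)
  have hinj : Function.Injective
      fun g : maxCentral H => (⟨_, hmem g⟩ : maxCentral H) := by
    rintro ⟨a, ha⟩ ⟨b, hb⟩ hab
    have h1 : α a ^ k = α b ^ k := mul_right_cancel (congrArg Subtype.val hab)
    refine Subtype.ext (α.injective ?_)
    obtain ⟨m, hm⟩ := Nat.exists_mul_mod_eq_one_of_coprime hk (by
      rw [hexp]; exact Nat.one_lt_pow (by omega) hp.1.one_lt)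
    have key : ∀ g : H, (g ^ k) ^ m = g := fun g => by
      rw [← pow_mul, Monoid.pow_eq_mod_exponent, hm.2, pow_one]
    rw [← key (α a), ← key (α b), h1]
  refine ⟨Equiv.ofBijective _ (Finite.injective_iff_bijective.1 hinj), ?_, rfl⟩
  rw [permGroup, if_neg (by omega)]
  exact Subgroup.subset_closure ⟨α, k, y, hk, fun z => rfl⟩

/-- A set of central elements of maximal order which is invariant, and reached from one of its
elements, is an orbit. -/
theorem image_orbit_eq {p e l : ℕ} [Fact p.Prime] [Finite H] (he : 1 ≤ e) (hl : 1 ≤ l)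
    (hexp : Monoid.exponent H = p ^ e) {X : Set H} {b : H} (hb : b ∈ X) (hX : X ⊆ maxCentral H)
    (hinv : ∀ h h', h ∈ maxCentral H → h' ∈ maxCentral H → PermRel p l h h' → (h' ∈ X ↔ h ∈ X))
    (hreach : ∀ h ∈ X, PermRel p l b h) (g : maxCentral H) (hg : (g : H) ∈ X) :
    Subtype.val '' MulAction.orbit (permGroup p H l) g = X := by
  have hσ : ∀ σ ∈ permGroup p H l, ∀ q : maxCentral H, ((σ q : H) ∈ X ↔ (q : H) ∈ X) := by
    intro σ hσ
    rw [permGroup, if_neg (by omega)] at hσ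
    induction hσ using Subgroup.closure_induction with
    | mem σ hσ =>
      obtain ⟨α, k, y, hk, h⟩ := hσ
      exact fun q => hinv _ _ q.2 (σ q).2 ⟨α, k, y, hk, h q⟩
    | one => exact fun q => Iff.rfl
    | mul a b _ _ ha hb => exact fun q => (ha (b q)).trans (hb q)
    | inv a _ ha =>
      intro q
      have := (ha (a⁻¹ q)).symm
      rwa [← Equiv.Perm.mul_apply, mul_inv_cancel, Equiv.Perm.one_apply] at this
  have horb : ∀ q : maxCentral H, (q : H) ∈ X →
      q ∈ MulAction.orbit (permGroup p H l) (⟨b, hX hb⟩ : maxCentral H) := by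
    intro q hq
    obtain ⟨σ, hσ, h⟩ := PermRel.exists_perm (h := ⟨b, hX hb⟩) he hl hexp (hreach q hq)
    exact ⟨⟨σ, hσ⟩, Subtype.ext h⟩
  ext q
  constructor
  · rintro ⟨_, ⟨σ, rfl⟩, rfl⟩
    exact (hσ σ.1 σ.2 g).2 hg
  · intro hq
    refine ⟨⟨q, hX hq⟩, ?_, rfl⟩
    rw [MulAction.orbit_eq_iff.2 (horb g hg)]
    exact horb ⟨q, hX hq⟩ hq

end

/-! ### The group `R` -/

section
variable (n : ℕ)

theorem w_pow_mul_z_pow (i j : ℕ) : w n ^ i * z n ^ j =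
    (Multiplicative.ofAdd (i : ZMod n),
      SemidirectProduct.inl (Multiplicative.ofAdd (j : ZMod n), 1)) := by
  have h1 : w n ^ i = (Multiplicative.ofAdd (i : ZMod n), 1) := by
    refine Prod.ext ?_ (one_pow i)
    apply Multiplicative.toAdd.injective
    simp [w]
  have h2 : z n ^ j = (1, SemidirectProduct.inl (Multiplicative.ofAdd (j : ZMod n), 1)) := by
    refine Prod.ext (one_pow j) ?_
    simp only [z, Prod.pow_snd]
    rw [← map_pow]
    congr 1
    refine Prod.ext ?_ (one_pow j)
    apply Multiplicative.toAdd.injective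
    simp
  rw [h1, h2, Prod.mk_mul_mk, one_mul, mul_one]

theorem mem_center_R_iff [NeZero n] {g : R n} :
    g ∈ Subgroup.center (R n) ↔ ∃ i j : ℕ, g = w n ^ i * z n ^ j := by
  simp only [w_pow_mul_z_pow]
  constructor
  · intro hg
    obtain ⟨u, ⟨⟨a, b⟩, c⟩⟩ := g
    have hx := congrArg (fun q => q.2.left.1.toAdd) (Subgroup.mem_center_iff.1 hg (x n))
    have hy := congrArg (fun q => q.2.left.1.toAdd) (Subgroup.mem_center_iff.1 hg (y n))
    simp [x, y, shear_apply] at hx hy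
    refine ⟨u.toAdd.val, a.toAdd.val, ?_⟩
    rw [ZMod.natCast_zmod_val, ZMod.natCast_zmod_val]
    refine Prod.ext rfl (SemidirectProduct.ext (Prod.ext rfl ?_) ?_)
    · simpa using hx
    · simpa using hy
  · rintro ⟨i, j, rfl⟩
    refine Subgroup.mem_center_iff.2 fun g => ?_
    obtain ⟨u, ⟨⟨a, b⟩, c⟩⟩ := g
    refine Prod.ext (mul_comm _ _) (SemidirectProduct.ext (Prod.ext ?_ ?_) ?_)
    · apply Multiplicative.toAdd.injective
      simp [shear_apply, add_comm]
    · simp [shear_apply]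
    · simp

theorem w_pow_mul_z_pow_eq_one_iff {i j : ℕ} : w n ^ i * z n ^ j = 1 ↔ n ∣ i ∧ n ∣ j := by
  rw [w_pow_mul_z_pow, Prod.ext_iff, SemidirectProduct.ext_iff, Prod.ext_iff]
  simp [← ZMod.natCast_eq_zero_iff, ofAdd_eq_one]

theorem commute_w_z : Commute (w n) (z n) := by
  refine Prod.ext (mul_comm _ _) ?_
  simp [w]

theorem w_pow_mul_z_pow_pow (i j k : ℕ) :
    (w n ^ i * z n ^ j) ^ k = w n ^ (i * k) * z n ^ (j * k) := by
  rw [((commute_w_z n).pow_pow i j).mul_pow, pow_mul, pow_mul]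

/-- The coordinates of a power; the quotient by `2` is exact. -/
theorem R_pow (g : R n) (k : ℕ) : (g ^ k).1.toAdd = k * g.1.toAdd ∧
    (g ^ k).2.right.toAdd = k * g.2.right.toAdd ∧
    (g ^ k).2.left.2.toAdd = k * g.2.left.2.toAdd ∧
    (g ^ k).2.left.1.toAdd = k * g.2.left.1.toAdd -
      (k * (k - 1) / 2 : ℕ) * (g.2.right.toAdd * g.2.left.2.toAdd) := by
  induction k with
  | zero => simp
  | succ k ih =>
    obtain ⟨h1, h2, h3, h4⟩ := ih
    rw [pow_succ]
    simp only [Prod.fst_mul, Prod.snd_mul, SemidirectProduct.mul_left, SemidirectProduct.mul_right,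
      shear_apply, toAdd_mul, toAdd_ofAdd, h1, h2, h3, h4, Nat.add_sub_cancel, Nat.cast_add,
      Nat.cast_one]
    refine ⟨by ring, by ring, by ring, ?_⟩
    have : (k + 1) * k / 2 = k * (k - 1) / 2 + k := by
      rw [← Finset.sum_range_id_mul_two, Nat.mul_div_cancel _ two_pos]
      have := Finset.sum_range_id_mul_two (k + 1)
      rw [Finset.sum_range_succ] at this
      simp only [Nat.add_sub_cancel] at this
      omega
    rw [this]
    push_cast
    ring

/-- For odd `n` the triangular number in `R_pow` is divisible by `n`. -/
theorem R_pow_eq_one (hn : Odd n) (g : R n) : g ^ n = 1 := by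
  obtain ⟨h1, h2, h3, h4⟩ := R_pow n g n
  have h5 : n * (n - 1) / 2 = n * ((n - 1) / 2) := by
    obtain ⟨m, rfl⟩ := hn
    rw [Nat.add_sub_cancel, Nat.mul_div_assoc _ (Dvd.intro _ rfl)]
  rw [h5, Nat.cast_mul] at h4
  simp only [CharP.cast_eq_zero, zero_mul, sub_zero] at h1 h2 h3 h4
  exact Prod.ext h1 (SemidirectProduct.ext (Prod.ext h4 h3) h2)

theorem exponent_R (hn : Odd n) : Monoid.exponent (R n) = n := by
  refine Nat.dvd_antisymm (Monoid.exponent_dvd_of_forall_pow_eq_one (R_pow_eq_one n hn)) ?_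
  have h1 : w n ^ Monoid.exponent (R n) * z n ^ 0 = 1 := by
    rw [Monoid.pow_exponent_eq_one, pow_zero, one_mul]
  exact ((w_pow_mul_z_pow_eq_one_iff n).1 h1).1

theorem z_mem_commutator : z n ∈ commutator (R n) := by
  rw [← commutator_y_x, commutator_eq_closure]
  refine Subgroup.subset_closure ⟨(y n)⁻¹, (x n)⁻¹, ?_⟩
  simp [commutatorElement_def]

theorem w_pow_mul_z_pow_mem_powCommutator_iff {m : ℕ} (hm : m ∣ n) {i j : ℕ} :
    w n ^ i * z n ^ j ∈ powCommutator (R n) m ↔ m ∣ i := by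
  have hz : z n ^ j ∈ powCommutator (R n) m :=
    pow_mem (Subgroup.mem_sup_right (z_mem_commutator n)) j
  rw [Subgroup.mul_mem_cancel_right _ hz]
  constructor
  · intro h
    -- the projection to `⟨w⟩` kills commutators
    have hle : powCommutator (R n) m ≤
        (powMonoidHom m : Multiplicative (ZMod n) →* _).range.comap (MonoidHom.fst _ _) := by
      refine sup_le ((Subgroup.closure_le _).2 ?_) ?_
      · rintro _ ⟨r, rfl⟩
        exact ⟨r.1, rfl⟩
      · refine (Abelianization.commutator_subset_ker (MonoidHom.fst _ _)).trans ?_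
        exact Subgroup.comap_mono bot_le
    obtain ⟨u, hu⟩ := hle h
    have h1 := congrArg Multiplicative.toAdd hu
    simp only [powMonoidHom_apply, toAdd_pow, MonoidHom.coe_fst, Prod.pow_fst, w, toAdd_ofAdd,
      nsmul_eq_mul, mul_one] at h1
    have h2 := congrArg (ZMod.castHom hm (ZMod m)) h1
    simp only [map_mul, map_natCast, CharP.cast_eq_zero, zero_mul] at h2
    exact (ZMod.natCast_eq_zero_iff _ _).1 h2.symm
  · rintro ⟨k, rfl⟩
    refine Subgroup.mem_sup_left (Subgroup.subset_closure ⟨w n ^ k, ?_⟩)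
    simp only
    rw [← pow_mul, mul_comm]

/-- The automorphism of `R` fixing `E` elementwise and mapping `w` to `w ^ s * z ^ t`. -/
def autR (s : (ZMod n)ˣ) (t : ZMod n) : MulAut (R n) where
  toFun g := (Multiplicative.ofAdd (s * g.1.toAdd),
    ⟨(Multiplicative.ofAdd (t * g.1.toAdd + g.2.left.1.toAdd), g.2.left.2), g.2.right⟩)
  invFun g := (Multiplicative.ofAdd (((s⁻¹ : (ZMod n)ˣ) : ZMod n) * g.1.toAdd),
    ⟨(Multiplicative.ofAdd (g.2.left.1.toAdd - t * (((s⁻¹ : (ZMod n)ˣ) : ZMod n) * g.1.toAdd)),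
      g.2.left.2), g.2.right⟩)
  left_inv g := by
    refine Prod.ext ?_ (SemidirectProduct.ext (Prod.ext ?_ rfl) rfl) <;>
    apply Multiplicative.toAdd.injective <;> simp
  right_inv g := by
    refine Prod.ext ?_ (SemidirectProduct.ext (Prod.ext ?_ rfl) rfl) <;>
    apply Multiplicative.toAdd.injective <;> simp
  map_mul' g h := by
    refine Prod.ext ?_ (SemidirectProduct.ext (Prod.ext ?_ ?_) rfl)
    · apply Multiplicative.toAdd.injective
      simp [mul_add]
    · apply Multiplicative.toAdd.injective
      simp only [Prod.fst_mul, Prod.snd_mul, SemidirectProduct.mul_left, shear_apply, toAdd_mul,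
        toAdd_ofAdd]
      ring
    · simp [shear_apply]

theorem exists_mulAut_R {s : ℕ} (hs : s.Coprime n) (t : ℕ) :
    ∃ α : MulAut (R n), α (w n) = w n ^ s * z n ^ t ∧ α (z n) = z n := by
  refine ⟨autR n (ZMod.unitOfCoprime s hs) t, ?_, ?_⟩
  · rw [w_pow_mul_z_pow]
    simp [autR, w]
  · simp [autR, z]

end

end

section

/-! ### The sets `𝒪_a` -/

section
variable {p e : ℕ}

theorem exponent_R_pow (hodd : Odd p) : Monoid.exponent (R (p ^ e)) = p ^ e :=
  exponent_R _ hodd.pow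

theorem w_pow_eq_one {i : ℕ} (hi : p ^ e ∣ i) : w (p ^ e) ^ i = 1 := by
  have := (w_pow_mul_z_pow_eq_one_iff (p ^ e) (i := i) (j := 0)).2 ⟨hi, dvd_zero _⟩
  simpa using this

theorem not_dvd_mod_pow_iff {k : ℕ} (hk : 1 ≤ k) (i : ℕ) : ¬ p ∣ i % p ^ k ↔ ¬ p ∣ i :=
  (Nat.dvd_mod_iff (dvd_pow_self p (by omega))).not

variable [hp : Fact p.Prime]

theorem w_pow_mul_z_pow_mem_maxCentral_iff (hodd : Odd p) (he : 1 ≤ e) {i j : ℕ} :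
    w (p ^ e) ^ i * z (p ^ e) ^ j ∈ maxCentral (R (p ^ e)) ↔ ¬ (p ∣ i ∧ p ∣ j) := by
  have hpe : p ^ e = p * p ^ (e - 1) := by rw [← pow_succ']; congr 1; omega
  have h0 : p ^ (e - 1) ≠ 0 := pow_ne_zero _ hp.1.ne_zero
  rw [mem_maxCentral_iff he (exponent_R_pow hodd), w_pow_mul_z_pow_pow, Ne,
    w_pow_mul_z_pow_eq_one_iff, hpe, Nat.mul_dvd_mul_iff_right (Nat.pos_of_ne_zero h0),
    Nat.mul_dvd_mul_iff_right (Nat.pos_of_ne_zero h0), ← hpe]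
  exact and_iff_right ((mem_center_R_iff _).2 ⟨i, j, rfl⟩)

/-- A uniform description of the sets `𝒪_a`: for `a ≥ 1` the condition `¬ (p ∣ i ∧ p ∣ j)` says
`p ∤ j`, while for `a = 0` it follows from `p ∤ i`. -/
theorem mem_O_iff {a : ℕ} (he : 1 ≤ e) (ha : a ≤ e) {g : R (p ^ e)} :
    g ∈ O p e a ↔ ∃ i j : ℕ, p ^ a ∣ i ∧ (a < e → ¬ p ^ (a + 1) ∣ i) ∧ ¬ (p ∣ i ∧ p ∣ j) ∧
      g = w (p ^ e) ^ i * z (p ^ e) ^ j := by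
  have hdvd : ∀ i, p ^ (a + 1) ∣ i * p ^ a ↔ p ∣ i := fun i => by
    rw [pow_succ', Nat.mul_dvd_mul_iff_right (pow_pos hp.1.pos a)]
  unfold O
  split_ifs with h1 h2
  · subst h1
    constructor
    · rintro ⟨i, j, hi, rfl⟩
      exact ⟨i, j, by simp, fun _ => by simpa using hi, fun h => hi h.1, rfl⟩
    · rintro ⟨i, j, -, hi, -, rfl⟩
      exact ⟨i, j, by simpa using hi (by omega), rfl⟩
  · constructor
    · rintro ⟨i, j, hi, hj, rfl⟩
      exact ⟨i * p ^ a, j, Dvd.intro_left _ rfl, fun _ => by rwa [hdvd], fun h => hj h.2, rfl⟩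
    · rintro ⟨i, j, ⟨k, rfl⟩, hi, hj, rfl⟩
      rw [mul_comm, hdvd] at hi
      refine ⟨k, j, hi h2, fun h => hj ⟨?_, h⟩, by rw [mul_comm]⟩
      exact (dvd_pow_self p h1).mul_right _
  · obtain rfl : a = e := by omega
    constructor
    · rintro ⟨j, hj, rfl⟩
      exact ⟨0, j, dvd_zero _, fun h => absurd h (lt_irrefl _), fun h => hj h.2, by simp⟩
    · rintro ⟨i, j, hi, -, hj, rfl⟩
      refine ⟨j, fun h => hj ⟨(dvd_pow_self p h1).trans hi, h⟩, ?_⟩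
      rw [w_pow_eq_one hi, one_mul]

theorem mem_O_iff_mem_powCommutator {a : ℕ} (hodd : Odd p) (he : 1 ≤ e) (ha : a ≤ e)
    {g : R (p ^ e)} : g ∈ O p e a ↔ g ∈ maxCentral (R (p ^ e)) ∧
      g ∈ powCommutator (R (p ^ e)) (p ^ a) ∧
      (a < e → g ∉ powCommutator (R (p ^ e)) (p ^ (a + 1))) := by
  rw [mem_O_iff he ha]
  constructor
  · rintro ⟨i, j, h1, h2, h3, rfl⟩
    rw [w_pow_mul_z_pow_mem_maxCentral_iff hodd he,
      w_pow_mul_z_pow_mem_powCommutator_iff _ (pow_dvd_pow p ha)]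
    refine ⟨h3, h1, fun h => ?_⟩
    rw [w_pow_mul_z_pow_mem_powCommutator_iff _ (pow_dvd_pow p h)]
    exact h2 h
  · rintro ⟨h1, h2, h3⟩
    obtain ⟨i, j, rfl⟩ := (mem_center_R_iff _).1 h1.1
    rw [w_pow_mul_z_pow_mem_maxCentral_iff hodd he] at h1
    rw [w_pow_mul_z_pow_mem_powCommutator_iff _ (pow_dvd_pow p ha)] at h2
    refine ⟨i, j, h2, fun h => ?_, h1, rfl⟩
    rw [← w_pow_mul_z_pow_mem_powCommutator_iff _ (pow_dvd_pow p h)]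
    exact h3 h

theorem mem_powCommutator_of_mem_O {a b : ℕ} (he : 1 ≤ e) (ha : a ≤ e) (hb : b ≤ e)
    {g : R (p ^ e)} (hg : g ∈ O p e a) : g ∈ powCommutator (R (p ^ e)) (p ^ b) ↔ b ≤ a := by
  obtain ⟨i, j, h1, h2, -, rfl⟩ := (mem_O_iff he ha).1 hg
  rw [w_pow_mul_z_pow_mem_powCommutator_iff _ (pow_dvd_pow p hb)]
  refine ⟨fun h => ?_, fun h => (pow_dvd_pow p h).trans h1⟩
  by_contra! hlt
  exact h2 (by omega) ((pow_dvd_pow p hlt).trans h)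

/-- The index `a` is the largest one with `g ∈ R ^ (p ^ a) * R'`. -/
theorem exists_mem_O {l : ℕ} (hodd : Odd p) (he : 1 ≤ e) (hl : l ≤ e) {g : R (p ^ e)}
    (hg : g ∈ maxCentral (R (p ^ e))) (hgl : g ∈ powCommutator (R (p ^ e)) (p ^ l)) :
    ∃ a, l ≤ a ∧ a ≤ e ∧ g ∈ O p e a := by
  classical
  refine ⟨Nat.findGreatest (fun a => g ∈ powCommutator (R (p ^ e)) (p ^ a)) e,
    Nat.le_findGreatest hl hgl, Nat.findGreatest_le e, ?_⟩
  rw [mem_O_iff_mem_powCommutator hodd he (Nat.findGreatest_le e)]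
  exact ⟨hg, Nat.findGreatest_spec (P := fun a => g ∈ powCommutator (R (p ^ e)) (p ^ a)) hl hgl,
    fun h => Nat.findGreatest_is_greatest (Nat.lt_succ_self _) h⟩

theorem exists_mem_O_of_mem_maxCentral (hodd : Odd p) (he : 1 ≤ e) {g : R (p ^ e)}
    (hg : g ∈ maxCentral (R (p ^ e))) : ∃ a, a ≤ e ∧ g ∈ O p e a := by
  obtain ⟨i, j, rfl⟩ := (mem_center_R_iff _).1 hg.1
  obtain ⟨a, -, h⟩ := exists_mem_O (l := 0) hodd he (Nat.zero_le _) hg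
    ((w_pow_mul_z_pow_mem_powCommutator_iff _ (by simp)).2 (by simp))
  exact ⟨a, h⟩

theorem mem_Otilde_iff {l : ℕ} (hodd : Odd p) (he : 1 ≤ e) (hl : l ≤ e) {g : R (p ^ e)} :
    g ∈ Otilde p e l ↔ g ∈ maxCentral (R (p ^ e)) ∧
      g ∈ powCommutator (R (p ^ e)) (p ^ l) := by
  simp only [Otilde, Set.mem_iUnion, Set.mem_Icc, exists_prop]
  constructor
  · rintro ⟨a, ⟨hla, hae⟩, hg⟩
    exact ⟨((mem_O_iff_mem_powCommutator hodd he hae).1 hg).1,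
      (mem_powCommutator_of_mem_O he hae hl hg).2 hla⟩
  · rintro ⟨h1, h2⟩
    obtain ⟨a, h3, h4, h5⟩ := exists_mem_O hodd he hl h1 h2
    exact ⟨a, ⟨h3, h4⟩, h5⟩

theorem O_index_unique {a b : ℕ} (he : 1 ≤ e) (ha : a ≤ e) (hb : b ≤ e)
    {g : R (p ^ e)} (hga : g ∈ O p e a) (hgb : g ∈ O p e b) : a = b :=
  le_antisymm ((mem_powCommutator_of_mem_O he hb ha hgb).1
    ((mem_powCommutator_of_mem_O he ha ha hga).2 le_rfl))
    ((mem_powCommutator_of_mem_O he ha hb hga).1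
    ((mem_powCommutator_of_mem_O he hb hb hgb).2 le_rfl))

/-- A representative `w ^ p ^ a * z` of the orbit `𝒪_a`. For `a = e` it equals `z`. -/
def baseO (p e a : ℕ) : R (p ^ e) := w (p ^ e) ^ p ^ a * z (p ^ e)

theorem baseO_mem_O {a : ℕ} (he : 1 ≤ e) (ha : a ≤ e) : baseO p e a ∈ O p e a := by
  refine (mem_O_iff he ha).2 ⟨p ^ a, 1, dvd_rfl, fun _ h => ?_, fun h => ?_, by simp [baseO]⟩
  · exact absurd ((Nat.pow_dvd_pow_iff_le_right hp.1.one_lt).1 h) (by omega)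
  · exact hp.1.one_lt.ne' (Nat.dvd_one.1 h.2)

theorem exists_powSubgroup_center_eq_w_pow {h : R (p ^ e)} {l i : ℕ} (hi : p ^ l ∣ i)
    (hh : h = w (p ^ e) ^ i) :
    ∃ y : powSubgroup (Subgroup.center (R (p ^ e))) (p ^ l),
      ((y : Subgroup.center (R (p ^ e))) : R (p ^ e)) = h := by
  obtain ⟨k, rfl⟩ := hi
  have hc : w (p ^ e) ^ k ∈ Subgroup.center (R (p ^ e)) :=
    (mem_center_R_iff _).2 ⟨k, 0, by simp⟩
  obtain ⟨y, hy⟩ := exists_powSubgroup_center_eq hc (p ^ l)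
  exact ⟨y, by rw [hy, hh, ← pow_mul, mul_comm]⟩

/-- Every `𝒪_a` is a single orbit of `Aut(R) × ℤ_{p ^ e}^*`. -/
theorem permRel_baseO (hodd : Odd p) (he : 1 ≤ e) {a : ℕ} (ha : a ≤ e) {h : R (p ^ e)}
    (hh : h ∈ O p e a) (l : ℕ) : PermRel p l (baseO p e a) h := by
  have hcop : ∀ {s : ℕ}, ¬ p ∣ s → s.Coprime (p ^ e) := fun hs =>
    Nat.Coprime.pow_right _ ((hp.1.coprime_iff_not_dvd).2 hs).symm
  obtain ⟨i, j, h1, h2, h3, rfl⟩ := (mem_O_iff he ha).1 hh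
  rcases Nat.eq_zero_or_pos a with rfl | ha0
  · have hi : ¬ p ∣ i := by simpa using h2 (by omega)
    -- `p ^ e - 1` represents `-1`, so the image of `w * z` has `z`-exponent `j`
    obtain ⟨α, hw, hz⟩ := exists_mulAut_R (p ^ e) (hcop hi) (j + (p ^ e - 1))
    refine ⟨α, 1, 1, by simp, ?_⟩
    have hz1 : z (p ^ e) ^ (p ^ e) = 1 := R_pow_eq_one _ hodd.pow _
    simp only [baseO, pow_zero, pow_one, map_mul, hw, hz, OneMemClass.coe_one, mul_one]
    rw [mul_assoc, ← pow_succ, add_assoc, Nat.sub_add_cancel (Nat.pos_of_ne_zero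
      (pow_ne_zero _ hp.1.ne_zero)), pow_add, hz1, mul_one]
  · have hj : ¬ p ∣ j := fun h => h3 ⟨(dvd_pow_self p ha0.ne').trans h1, h⟩
    obtain ⟨i, rfl⟩ := h1
    obtain ⟨j', -, hj'⟩ := Nat.exists_mul_mod_eq_one_of_coprime (hcop hj)
      (Nat.one_lt_pow (by omega) hp.1.one_lt)
    have hjj : ∀ r : R (p ^ e), r ^ (j' * j) = r := fun r => by
      rw [Monoid.pow_eq_mod_exponent r, exponent_R_pow hodd, mul_comm, hj', pow_one]
    have hpj' : ¬ p ∣ j' := by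
      intro h
      have h4 : p ∣ j * j' % p ^ e := (Nat.dvd_mod_iff (dvd_pow_self p (by omega))).2
        (h.mul_left _)
      rw [hj'] at h4
      exact hp.1.one_lt.ne' (Nat.dvd_one.1 h4)
    -- for `a = e` both powers of `w` are trivial, and any unit may serve as `s`
    obtain ⟨s, hs, hs'⟩ : ∃ s, ¬ p ∣ s ∧ w (p ^ e) ^ (p ^ a * i) = w (p ^ e) ^ (s * p ^ a) := by
      rcases ha.lt_or_eq with ha1 | rfl
      · refine ⟨i, fun h => h2 ha1 ?_, by rw [mul_comm]⟩
        rw [pow_succ]; exact Nat.mul_dvd_mul_left _ h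
      · refine ⟨1, fun h => hp.1.one_lt.ne' (Nat.dvd_one.1 h), ?_⟩
        rw [w_pow_eq_one (Dvd.intro _ rfl), w_pow_eq_one (Dvd.intro_left _ rfl)]
    -- the `j`-th power takes care of `z`; the factor `j'` undoes its effect on `w`
    obtain ⟨α, hw, hz⟩ := exists_mulAut_R (p ^ e) (s := s * j')
      (hcop fun h => ((hp.1.dvd_mul).1 h).elim hs hpj') 0
    refine ⟨α, j, 1, by rw [coprime_exponent_iff he (exponent_R_pow hodd)]; exact hj, ?_⟩
    have h5 := w_pow_mul_z_pow_pow (p ^ e) (s * j' * p ^ a) 1 j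
    rw [pow_one, one_mul] at h5
    simp only [baseO, map_mul, map_pow, hw, hz, OneMemClass.coe_one, mul_one, pow_zero]
    rw [← pow_mul, h5, hs', show s * j' * p ^ a * j = s * p ^ a * (j' * j) by ring,
      pow_mul _ _ (j' * j), hjj]

/-- From `baseO p e e = z` every element of the union of `𝒪_l, …, 𝒪_e` is reached by a power
and a factor in `⟨w⟩ ^ p ^ l`; no automorphism is needed. -/
theorem permRel_z (hodd : Odd p) (he : 1 ≤ e) {l : ℕ} (hl : 1 ≤ l) (hle : l ≤ e)
    {h : R (p ^ e)} (hh : h ∈ Otilde p e l) : PermRel p l (baseO p e e) h := by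
  rw [mem_Otilde_iff hodd he hle] at hh
  obtain ⟨h1, h2⟩ := hh
  obtain ⟨i, j, rfl⟩ := (mem_center_R_iff _).1 h1.1
  rw [w_pow_mul_z_pow_mem_maxCentral_iff hodd he] at h1
  rw [w_pow_mul_z_pow_mem_powCommutator_iff _ (pow_dvd_pow p hle)] at h2
  obtain ⟨y, hy⟩ := exists_powSubgroup_center_eq_w_pow (e := e) h2 rfl
  refine ⟨1, j, y, ?_, ?_⟩
  · rw [coprime_exponent_iff he (exponent_R_pow hodd)]
    exact fun h => h1 ⟨(dvd_pow_self p (by omega)).trans h2, h⟩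
  · rw [hy, baseO, w_pow_eq_one dvd_rfl, one_mul, MulAut.one_apply,
      ((commute_w_z _).pow_pow i j).eq]

theorem O_subset_maxCentral {a : ℕ} (hodd : Odd p) (he : 1 ≤ e) (ha : a ≤ e) :
    O p e a ⊆ maxCentral (R (p ^ e)) :=
  fun _ hg => ((mem_O_iff_mem_powCommutator hodd he ha).1 hg).1

theorem image_orbit_of_mem_O {a l : ℕ} (hodd : Odd p) (he : 1 ≤ e) (hl : 1 ≤ l)
    (hle : l ≤ e) (hal : a < l) (g : maxCentral (R (p ^ e))) (hg : (g : R (p ^ e)) ∈ O p e a) :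
    Subtype.val '' MulAction.orbit (permGroup p (R (p ^ e)) l) g = O p e a := by
  have ha : a ≤ e := by omega
  refine image_orbit_eq he hl (exponent_R_pow hodd) (baseO_mem_O he ha)
    (O_subset_maxCentral hodd he ha) (fun h h' hm hm' hrel => ?_)
    (fun h hh => permRel_baseO hodd he ha hh l) g hg
  rw [mem_O_iff_mem_powCommutator hodd he ha, mem_O_iff_mem_powCommutator hodd he ha,
    hrel.mem_powCommutator_iff hal.le, hrel.mem_powCommutator_iff hal]
  simp [hm, hm']

theorem image_orbit_of_mem_Otilde {l : ℕ} (hodd : Odd p) (he : 1 ≤ e) (hl : 1 ≤ l)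
    (hle : l ≤ e) (g : maxCentral (R (p ^ e))) (hg : (g : R (p ^ e)) ∈ Otilde p e l) :
    Subtype.val '' MulAction.orbit (permGroup p (R (p ^ e)) l) g = Otilde p e l := by
  have hb : baseO p e e ∈ Otilde p e l := by
    simp only [Otilde, Set.mem_iUnion, Set.mem_Icc, exists_prop]
    exact ⟨e, ⟨hle, le_rfl⟩, baseO_mem_O he le_rfl⟩
  refine image_orbit_eq he hl (exponent_R_pow hodd) hb
    (fun h hh => ((mem_Otilde_iff hodd he hle).1 hh).1) (fun h h' hm hm' hrel => ?_)
    (fun h hh => permRel_z hodd he hl hle hh) g hg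
  rw [mem_Otilde_iff hodd he hle, mem_Otilde_iff hodd he hle, hrel.mem_powCommutator_iff le_rfl]
  simp [hm, hm']

theorem permOrbits_R {l : ℕ} (hodd : Odd p) (he : 1 ≤ e) (hl : 1 ≤ l) (hle : l ≤ e) :
    permOrbits p (R (p ^ e)) l = {X | (∃ a < l, X = O p e a) ∨ X = Otilde p e l} := by
  ext X
  constructor
  · rintro ⟨g, rfl⟩
    obtain ⟨a, ha, hga⟩ := exists_mem_O_of_mem_maxCentral hodd he g.2
    rcases lt_or_ge a l with hal | hal
    · exact Or.inl ⟨a, hal, image_orbit_of_mem_O hodd he hl hle hal g hga⟩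
    · refine Or.inr (image_orbit_of_mem_Otilde hodd he hl hle g ?_)
      simp only [Otilde, Set.mem_iUnion, Set.mem_Icc, exists_prop]
      exact ⟨a, ⟨hal, ha⟩, hga⟩
  · rintro (⟨a, hal, rfl⟩ | rfl)
    · have ha : a ≤ e := by omega
      exact ⟨⟨_, O_subset_maxCentral hodd he ha (baseO_mem_O he ha)⟩,
        image_orbit_of_mem_O hodd he hl hle hal _ (baseO_mem_O he ha)⟩
    · refine ⟨⟨_, O_subset_maxCentral hodd he le_rfl (baseO_mem_O he le_rfl)⟩,
        image_orbit_of_mem_Otilde hodd he hl hle _ ?_⟩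
      simp only [Otilde, Set.mem_iUnion, Set.mem_Icc, exists_prop]
      exact ⟨e, ⟨hle, le_rfl⟩, baseO_mem_O he le_rfl⟩

theorem permOrbits_R_self (hodd : Odd p) (he : 1 ≤ e) :
    permOrbits p (R (p ^ e)) e = {X | ∃ a ≤ e, X = O p e a} := by
  have hO : Otilde p e e = O p e e := by simp [Otilde]
  rw [permOrbits_R hodd he he le_rfl, hO]
  ext X
  constructor
  · rintro (⟨a, ha, rfl⟩ | rfl)
    · exact ⟨a, ha.le, rfl⟩
    · exact ⟨e, le_rfl, rfl⟩
  · rintro ⟨a, ha, rfl⟩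
    rcases ha.lt_or_eq with h | rfl
    · exact Or.inl ⟨a, h, rfl⟩
    · exact Or.inr rfl

theorem ncard_permOrbits_R_self (hodd : Odd p) (he : 1 ≤ e) :
    (permOrbits p (R (p ^ e)) e).ncard = e + 1 := by
  have h1 : permOrbits p (R (p ^ e)) e = O p e '' ((Finset.range (e + 1) : Finset ℕ) : Set ℕ) := by
    rw [permOrbits_R_self hodd he]
    ext X
    simp [eq_comm]
  rw [h1, Set.InjOn.ncard_image, Set.ncard_coe_finset, Finset.card_range]
  intro a ha b hb hab
  simp only [Finset.coe_range, Set.mem_Iio, Nat.lt_succ_iff] at ha hb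
  have := baseO_mem_O (p := p) he ha
  exact O_index_unique he ha hb this (hab ▸ this)

/-! ### The cardinalities of the sets `𝒪_a` -/

theorem card_filter_not_dvd_range {k : ℕ} (hk : 1 ≤ k) :
    ((Finset.range (p ^ k)).filter fun i => ¬ p ∣ i).card = p ^ (k - 1) * (p - 1) := by
  rw [← Nat.totient_prime_pow hp.1 hk, Nat.totient]
  congr 1
  refine Finset.filter_congr fun i _ => ?_
  rw [Nat.coprime_pow_left_iff hk, hp.1.coprime_iff_not_dvd]

/-- The common count behind the cardinalities: the exponents of `w ^ p ^ a` and `z` matter only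
modulo `p ^ (e - a)` and `p ^ e`. -/
theorem ncard_w_pow_mul_z_pow {a : ℕ} (ha : a ≤ e) (P Q : ℕ → Prop) [DecidablePred P]
    [DecidablePred Q] (hP : ∀ i, P (i % p ^ (e - a)) ↔ P i) (hQ : ∀ j, Q (j % p ^ e) ↔ Q j) :
    {g | ∃ i j : ℕ, P i ∧ Q j ∧ g = w (p ^ e) ^ (i * p ^ a) * z (p ^ e) ^ j}.ncard =
      ((Finset.range (p ^ (e - a))).filter P).card * ((Finset.range (p ^ e)).filter Q).card := by
  have hpe : p ^ e = p ^ (e - a) * p ^ a := by rw [← pow_add, Nat.sub_add_cancel ha]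
  have hiff : ∀ i j i' j' : ℕ, w (p ^ e) ^ (i * p ^ a) * z (p ^ e) ^ j =
      w (p ^ e) ^ (i' * p ^ a) * z (p ^ e) ^ j' ↔
      i ≡ i' [MOD p ^ (e - a)] ∧ j ≡ j' [MOD p ^ e] := by
    intro i j i' j'
    rw [w_pow_mul_z_pow, w_pow_mul_z_pow]
    simp only [Prod.mk.injEq, SemidirectProduct.inl_inj, EmbeddingLike.apply_eq_iff_eq, and_true,
      ZMod.natCast_eq_natCast_iff]
    refine and_congr_left fun _ => ⟨fun h => ?_, fun h => ?_⟩
    · rw [hpe] at h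
      exact Nat.ModEq.mul_right_cancel' (pow_ne_zero _ hp.1.ne_zero) h
    · have := h.mul_right' (p ^ a)
      rwa [← hpe] at this
  rw [← Finset.card_product, ← Set.ncard_coe_finset, ← Set.InjOn.ncard_image
    (f := fun q : ℕ × ℕ => w (p ^ e) ^ (q.1 * p ^ a) * z (p ^ e) ^ q.2)]
  · congr 1
    ext g
    constructor
    · rintro ⟨i, j, hi, hj, rfl⟩
      refine ⟨(i % p ^ (e - a), j % p ^ e), ?_, ?_⟩
      · simp only [Finset.coe_product, Set.mem_prod, Finset.mem_coe, Finset.mem_filter,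
          Finset.mem_range, hP, hQ]
        exact ⟨⟨Nat.mod_lt _ (pow_pos hp.1.pos _), hi⟩, Nat.mod_lt _ (pow_pos hp.1.pos _), hj⟩
      · exact (hiff _ _ _ _).2 ⟨Nat.mod_modEq _ _, Nat.mod_modEq _ _⟩
    · rintro ⟨⟨i, j⟩, hq, rfl⟩
      simp only [Finset.coe_product, Set.mem_prod, Finset.mem_coe, Finset.mem_filter] at hq
      exact ⟨i, j, hq.1.2, hq.2.2, rfl⟩
  · rintro ⟨i, j⟩ hq ⟨i', j'⟩ hq' h
    simp only [Finset.coe_product, Set.mem_prod, Finset.mem_coe, Finset.mem_filter,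
      Finset.mem_range] at hq hq'
    obtain ⟨h1, h2⟩ := (hiff _ _ _ _).1 h
    exact Prod.ext (h1.eq_of_lt_of_lt hq.1.1 hq'.1.1) (h2.eq_of_lt_of_lt hq.2.1 hq'.2.1)

theorem ncard_O_zero (he : 1 ≤ e) : (O p e 0).ncard = p ^ (2 * e - 1) * (p - 1) := by
  have h := ncard_w_pow_mul_z_pow (p := p) (Nat.zero_le e) (fun i => ¬ p ∣ i) (fun _ => True)
    (not_dvd_mod_pow_iff he) (fun _ => Iff.rfl)
  rw [Nat.sub_zero, card_filter_not_dvd_range he, Finset.filter_true, Finset.card_range] at h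
  simp only [pow_zero, mul_one, true_and] at h
  rw [O, if_pos rfl, h, mul_right_comm, ← pow_add]
  congr 2; omega

theorem ncard_O_of_lt {a : ℕ} (ha : 1 ≤ a) (hae : a < e) :
    (O p e a).ncard = p ^ (2 * e - 2 - a) * (p - 1) ^ 2 := by
  have h := ncard_w_pow_mul_z_pow (p := p) hae.le (fun i => ¬ p ∣ i) (fun j => ¬ p ∣ j)
    (not_dvd_mod_pow_iff (by omega)) (not_dvd_mod_pow_iff (by omega))
  rw [card_filter_not_dvd_range (by omega), card_filter_not_dvd_range (by omega)] at h
  rw [O, if_neg (by omega), if_pos hae, h, mul_mul_mul_comm, ← pow_add, ← sq]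
  congr 2; omega

theorem ncard_O_self (he : 1 ≤ e) : (O p e e).ncard = p ^ (e - 1) * (p - 1) := by
  have h := ncard_w_pow_mul_z_pow (p := p) le_rfl (fun _ => True) (fun j => ¬ p ∣ j)
    (fun _ => Iff.rfl) (not_dvd_mod_pow_iff he)
  rw [card_filter_not_dvd_range he, Finset.filter_true, Finset.card_range, Nat.sub_self, pow_zero,
    one_mul] at h
  rw [O, if_neg (by omega), if_neg (lt_irrefl e), ← h]
  congr 1
  ext g
  constructor
  · rintro ⟨j, hj, rfl⟩
    exact ⟨0, j, trivial, hj, by simp⟩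
  · rintro ⟨i, j, -, hj, rfl⟩
    exact ⟨j, hj, by rw [w_pow_eq_one (Dvd.intro_left _ rfl), one_mul]⟩

end

end

section

/-! ### Ranks -/

section
variable {p : ℕ} [hp : Fact p.Prime]

/-- The images of a generating set span any elementary abelian quotient. -/
theorem finrank_le_rank {G V : Type} [Group G] [Finite G] [AddCommGroup V] [Module (ZMod p) V]
    (f : G →* Multiplicative V) (hf : Function.Surjective f) :
    Module.finrank (ZMod p) V ≤ Group.rank G := by
  classical
  obtain ⟨S, hS, hS'⟩ := Group.rank_spec G
  have hspan : Submodule.span (ZMod p) ((S.image fun g => (f g).toAdd : Finset V) : Set V) = ⊤ := by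
    refine (Submodule.eq_top_iff').2 fun v => ?_
    obtain ⟨g, hg⟩ := hf (Multiplicative.ofAdd v)
    have key : ∀ g : G, (f g).toAdd ∈
        Submodule.span (ZMod p) ((S.image fun g => (f g).toAdd : Finset V) : Set V) := by
      intro g
      have hmem : g ∈ Subgroup.closure (S : Set G) := by rw [hS']; exact Subgroup.mem_top g
      induction hmem using Subgroup.closure_induction with
      | mem g hg =>
        exact Submodule.subset_span (Finset.mem_coe.2 (Finset.mem_image_of_mem _ hg))
      | one => rw [map_one]; exact zero_mem _
      | mul a b _ _ ha hb => rw [map_mul]; exact add_mem ha hb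
      | inv a _ ha => rw [map_inv]; exact neg_mem ha
    have := key g
    rwa [hg] at this
  have h1 := finrank_span_finset_le_card (R := ZMod p) (S.image fun g => (f g).toAdd)
  rw [Set.finrank, hspan, finrank_top] at h1
  exact h1.trans (Finset.card_image_le.trans hS.le)

/-- If an elementary abelian quotient of `H` kills `h`, then `p ∣ d` makes room for one more
generator in the extension. -/
theorem finrank_succ_le_rank_trivExt {H V : Type} [Group H] [Finite H] [AddCommGroup V]
    [Module (ZMod p) V] [Module.Finite (ZMod p) V] {d : ℕ} [NeZero d] (hd : p ∣ d)
    {h : Subgroup.center H}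
    (φ : H →* Multiplicative V) (hφ : Function.Surjective φ) (hh : φ h = 1) :
    Module.finrank (ZMod p) V + 1 ≤ Group.rank (TrivExt d h) := by
  let F : Multiplicative (ZMod (d * orderOf (h : H))) × H →* Multiplicative (ZMod p × V) :=
    { toFun := fun q => Multiplicative.ofAdd
        (ZMod.castHom (hd.mul_right (orderOf (h : H))) (ZMod p) q.1.toAdd, (φ q.2).toAdd)
      map_one' := by
        rw [Prod.fst_one, Prod.snd_one, map_one φ, toAdd_one, toAdd_one, map_zero]; rfl
      map_mul' := fun q r => by
        rw [Prod.fst_mul, Prod.snd_mul, map_mul φ, toAdd_mul, toAdd_mul, map_add]; rfl }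
  have hker : amalgKernel d h ≤ F.ker := by
    refine (Subgroup.zpowers_le).2 ?_
    rw [MonoidHom.mem_ker]
    have h1 : ((d : ℕ) : ZMod p) = 0 := (ZMod.natCast_eq_zero_iff _ _).2 hd
    simp only [F, MonoidHom.coe_mk, OneHom.coe_mk, InvMemClass.coe_inv, map_inv, hh, inv_one,
      toAdd_pow, toAdd_ofAdd, nsmul_eq_mul, mul_one, map_natCast, h1]
    rfl
  have hsurj : Function.Surjective (QuotientGroup.lift (amalgKernel d h) F hker) := by
    intro v
    obtain ⟨g, hg⟩ := hφ (Multiplicative.ofAdd v.toAdd.2)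
    obtain ⟨i, hi⟩ := ZMod.intCast_surjective v.toAdd.1
    refine ⟨QuotientGroup.mk (Multiplicative.ofAdd (i : ZMod (d * orderOf (h : H))), g), ?_⟩
    rw [QuotientGroup.lift_mk]
    simp only [F, MonoidHom.coe_mk, OneHom.coe_mk, toAdd_ofAdd, map_intCast, hi, hg]
    rfl
  have := finrank_le_rank (p := p) _ hsurj
  rwa [Module.finrank_prod, Module.finrank_self, add_comm] at this

/-- As `c ^ d` is identified with `h`, the element `h` is not needed as a generator. -/
theorem rank_trivExt_le {H : Type} [Group H] [Finite H] {d : ℕ} [NeZero d] {h : Subgroup.center H}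
    (S : Finset H) (hS : Subgroup.closure (insert (h : H) (S : Set H)) = ⊤) :
    Group.rank (TrivExt d h) ≤ S.card + 1 := by
  classical
  obtain ⟨c, ι, T⟩ := IsTrivExt.exists_trivExt (NeZero.ne d) h
  have htop : Subgroup.closure ((insert c (S.image ι) : Finset (TrivExt d h)) : Set (TrivExt d h))
      = ⊤ := by
    set K := Subgroup.closure ((insert c (S.image ι) : Finset (TrivExt d h)) : Set (TrivExt d h))
    have hc : c ∈ K := Subgroup.subset_closure (by simp)
    have hι : Subgroup.closure (insert (h : H) (S : Set H)) ≤ K.comap ι := by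
      refine (Subgroup.closure_le _).2 (Set.insert_subset ?_ fun s hs => ?_)
      · change ι h ∈ K
        rw [← T.pow_eq]
        exact pow_mem hc d
      · refine Subgroup.subset_closure ?_
        rw [Finset.coe_insert, Finset.coe_image]
        exact Or.inr ⟨s, hs, rfl⟩
    refine (Subgroup.eq_top_iff' K).2 fun g => ?_
    obtain ⟨i, r, rfl⟩ := T.gen g
    exact mul_mem (zpow_mem hc i) (hι (hS ▸ Subgroup.mem_top r))
  refine (Group.rank_le htop).trans ((Finset.card_insert_le _ _).trans ?_)
  exact Nat.succ_le_succ Finset.card_image_le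

end

/-- `R` is generated by `w`, `x` and `y`. -/
theorem eq_top_of_mem {n : ℕ} [NeZero n] {K : Subgroup (R n)} (hw : w n ∈ K) (hx : x n ∈ K)
    (hy : y n ∈ K) : K = ⊤ := by
  have hz : z n ∈ K := by
    rw [← commutator_y_x]
    exact mul_mem (mul_mem (mul_mem (inv_mem hy) (inv_mem hx)) hy) hx
  refine (Subgroup.eq_top_iff' K).2 fun g => ?_
  obtain ⟨u, ⟨⟨a, b⟩, c⟩⟩ := g
  have hyb : y n ^ b.toAdd.val = (1, SemidirectProduct.inl (1, b)) := by
    refine Prod.ext (one_pow _) ?_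
    simp only [y, Prod.pow_snd]
    rw [← map_pow]
    refine congrArg _ (Prod.ext (one_pow _) ?_)
    apply Multiplicative.toAdd.injective
    simp
  have hxc : x n ^ c.toAdd.val = (1, SemidirectProduct.inr c) := by
    refine Prod.ext (one_pow _) ?_
    simp only [x, Prod.pow_snd]
    rw [← map_pow]
    refine congrArg _ ?_
    apply Multiplicative.toAdd.injective
    simp
  have hg : ((u, ⟨(a, b), c⟩) : R n) = w n ^ u.toAdd.val * z n ^ a.toAdd.val *
      y n ^ b.toAdd.val * x n ^ c.toAdd.val := by
    rw [w_pow_mul_z_pow, hyb, hxc]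
    refine Prod.ext ?_ (SemidirectProduct.ext (Prod.ext ?_ ?_) ?_) <;>
      simp
  rw [hg]
  exact mul_mem (mul_mem (mul_mem (pow_mem hw _) (pow_mem hz _)) (pow_mem hy _)) (pow_mem hx _)

section
variable {p e : ℕ} [hp : Fact p.Prime]

/-- The projection of `R` onto the elementary abelian quotient of order `p ^ 2` of `E`. -/
def projE (n : ℕ) (hn : p ∣ n) : R n →* Multiplicative (ZMod p × ZMod p) where
  toFun g := Multiplicative.ofAdd (ZMod.castHom hn (ZMod p) g.2.left.2.toAdd,
    ZMod.castHom hn (ZMod p) g.2.right.toAdd)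
  map_one' := by simp
  map_mul' g h := by simp [shear_apply, ← ofAdd_add, ZMod.cast_add hn]

/-- The projection of `R` onto its elementary abelian quotient of order `p ^ 3`. -/
def projR (n : ℕ) (hn : p ∣ n) : R n →* Multiplicative (ZMod p × ZMod p × ZMod p) where
  toFun g := Multiplicative.ofAdd (ZMod.castHom hn (ZMod p) g.1.toAdd, (projE n hn g).toAdd)
  map_one' := by simp
  map_mul' g h := by simp [← ofAdd_add, ZMod.cast_add hn]

theorem projE_surjective (n : ℕ) (hn : p ∣ n) : Function.Surjective (projE n hn) := by
  intro v
  obtain ⟨i, hi⟩ := ZMod.intCast_surjective v.toAdd.1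
  obtain ⟨j, hj⟩ := ZMod.intCast_surjective v.toAdd.2
  refine ⟨(1, ⟨(1, Multiplicative.ofAdd (i : ZMod n)), Multiplicative.ofAdd (j : ZMod n)⟩), ?_⟩
  refine Multiplicative.toAdd.injective (Prod.ext ?_ ?_)
  · exact (map_intCast (ZMod.castHom hn (ZMod p)) i).trans hi
  · exact (map_intCast (ZMod.castHom hn (ZMod p)) j).trans hj

theorem projR_surjective (n : ℕ) (hn : p ∣ n) : Function.Surjective (projR n hn) := by
  intro v
  obtain ⟨i, hi⟩ := ZMod.intCast_surjective v.toAdd.1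
  obtain ⟨g, hg⟩ := projE_surjective n hn (Multiplicative.ofAdd v.toAdd.2)
  refine ⟨(Multiplicative.ofAdd (i : ZMod n), g.2), ?_⟩
  refine Multiplicative.toAdd.injective (Prod.ext ?_ ?_)
  · exact (map_intCast (ZMod.castHom hn (ZMod p)) i).trans hi
  · exact congrArg Multiplicative.toAdd hg

theorem projE_w_pow_mul_z_pow (n : ℕ) (hn : p ∣ n) (i j : ℕ) :
    projE n hn (w n ^ i * z n ^ j) = 1 := by
  rw [w_pow_mul_z_pow]
  simp [projE]

theorem projR_w_pow_mul_z_pow (n : ℕ) (hn : p ∣ n) {i : ℕ} (hi : p ∣ i) (j : ℕ) :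
    projR n hn (w n ^ i * z n ^ j) = 1 := by
  refine Multiplicative.toAdd.injective (Prod.ext ?_ ?_)
  · change ZMod.castHom hn (ZMod p) (w n ^ i * z n ^ j).1.toAdd = 0
    rw [w_pow_mul_z_pow, toAdd_ofAdd, map_natCast, (ZMod.natCast_eq_zero_iff _ _).2 hi]
  · exact congrArg Multiplicative.toAdd (projE_w_pow_mul_z_pow n hn i j)

theorem rank_R (he : 1 ≤ e) : Group.rank (R (p ^ e)) = 3 := by
  classical
  refine le_antisymm ?_ ?_
  · have htop : Subgroup.closure (({w (p ^ e), x (p ^ e), y (p ^ e)} : Finset (R (p ^ e))) :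
        Set (R (p ^ e))) = ⊤ :=
      eq_top_of_mem (Subgroup.subset_closure (by simp)) (Subgroup.subset_closure (by simp))
        (Subgroup.subset_closure (by simp))
    exact (Group.rank_le htop).trans Finset.card_le_three
  · have h := finrank_le_rank (p := p) _ (projR_surjective (p ^ e) (dvd_pow_self p (by omega)))
    simpa [Module.finrank_prod] using h

theorem rank_trivExt_baseO {a l : ℕ} (he : 1 ≤ e) (ha : 1 ≤ a) (hl : 1 ≤ l)
    {h : Subgroup.center (R (p ^ e))} (hh : (h : R (p ^ e)) = baseO p e a) :
    Group.rank (TrivExt (p ^ l) h) = 4 := by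
  classical
  refine le_antisymm ?_ ?_
  · refine (rank_trivExt_le {w (p ^ e), x (p ^ e), y (p ^ e)} ?_).trans
      (Nat.succ_le_succ Finset.card_le_three)
    exact eq_top_of_mem (Subgroup.subset_closure (by simp)) (Subgroup.subset_closure (by simp))
        (Subgroup.subset_closure (by simp))
  · have h := finrank_succ_le_rank_trivExt (p := p) (d := p ^ l) (h := h)
      (dvd_pow_self p (by omega)) _ (projR_surjective (p ^ e) (dvd_pow_self p (by omega)))
      (by
        have := projR_w_pow_mul_z_pow (p ^ e) (dvd_pow_self p (show e ≠ 0 by omega))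
          (dvd_pow_self p (show a ≠ 0 by omega)) 1
        rwa [pow_one, ← baseO, ← hh] at this)
    simpa [Module.finrank_prod] using h

theorem rank_trivExt_baseO_zero {l : ℕ} (he : 1 ≤ e) (hl : 1 ≤ l)
    {h : Subgroup.center (R (p ^ e))} (hh : (h : R (p ^ e)) = baseO p e 0) :
    Group.rank (TrivExt (p ^ l) h) = 3 := by
  classical
  have hh' : (h : R (p ^ e)) = w (p ^ e) * z (p ^ e) := by rw [hh, baseO, pow_zero, pow_one]
  refine le_antisymm ?_ ?_
  · refine (rank_trivExt_le {x (p ^ e), y (p ^ e)} ?_).trans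
      (Nat.succ_le_succ Finset.card_le_two)
    set K := Subgroup.closure (insert (h : R (p ^ e))
      (({x (p ^ e), y (p ^ e)} : Finset (R (p ^ e))) : Set (R (p ^ e)))) with hK
    have hx : x (p ^ e) ∈ K := Subgroup.subset_closure (by simp)
    have hy : y (p ^ e) ∈ K := Subgroup.subset_closure (by simp)
    have hz : z (p ^ e) ∈ K := by
      rw [← commutator_y_x]
      exact mul_mem (mul_mem (mul_mem (inv_mem hy) (inv_mem hx)) hy) hx
    have hwz : w (p ^ e) * z (p ^ e) ∈ K := by
      rw [← hh']; exact Subgroup.subset_closure (by simp)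
    exact eq_top_of_mem ((Subgroup.mul_mem_cancel_right _ hz).1 hwz) hx hy
  · have h := finrank_succ_le_rank_trivExt (p := p) (d := p ^ l) (h := h)
      (dvd_pow_self p (by omega)) _ (projE_surjective (p ^ e) (dvd_pow_self p (by omega)))
      (by
        have := projE_w_pow_mul_z_pow (p ^ e) (dvd_pow_self p (show e ≠ 0 by omega)) 1 1
        rwa [pow_one, pow_one, ← hh'] at this)
    simpa [Module.finrank_prod] using h

end

end

/-! ### Trivial cyclic extensions as vertices of the tree -/

section
variable {p e : ℕ} {R : Type} [Group R] [Finite R]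

theorem isoType_eq_of_isTrivExt {G : Type} [Group G] [Finite G] {d : ℕ} [NeZero d]
    {h : Subgroup.center R} {c : G} {ι : R →* G} (T : IsTrivExt d (h : R) c ι) :
    isoType G = isoType (TrivExt d h) := by
  obtain ⟨f⟩ := T.nonempty_equiv
  exact isoType_eq_iff.2 ⟨f.symm⟩

theorem nonempty_trivExt_one_equiv (h : Subgroup.center R) :
    Nonempty (TrivExt (p ^ 0) h ≃* R) := by
  refine IsTrivExt.nonempty_equiv (c := (h : R)) (ι := MonoidHom.id R) ⟨fun _ _ h => h, fun g => ?_,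
    by simp, fun i _ => by simp, fun g => ⟨0, g, by simp⟩⟩
  exact (Subgroup.mem_center_iff.1 h.2 g).symm

variable [hp : Fact p.Prime]

theorem card_trivExt (d : ℕ) [NeZero d] (h : Subgroup.center R) :
    Nat.card (TrivExt d h) = d * Nat.card R := by
  obtain ⟨c, ι, T⟩ := IsTrivExt.exists_trivExt (NeZero.ne d) h
  exact T.card_eq (NeZero.ne d)

/-- The order of a trivial cyclic extension determines its level. -/
theorem eq_of_isoType_trivExt_eq {l m : ℕ} {h h' : Subgroup.center R}
    (heq : isoType (TrivExt (p ^ l) h) = isoType (TrivExt (p ^ m) h')) : l = m := by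
  obtain ⟨f⟩ := isoType_eq_iff.1 heq
  have := Nat.card_congr f.toEquiv
  rw [card_trivExt, card_trivExt] at this
  exact Nat.pow_right_injective hp.1.two_le (Nat.eq_of_mul_eq_mul_right Nat.card_pos this)

variable (he : 1 ≤ e) (hexp : Monoid.exponent R = p ^ e) (hR : ¬ IsGK p R)
  {h : Subgroup.center R} (ho : orderOf (h : R) = p ^ e)

include he hexp ho

theorem isGK_trivExt (l : ℕ) : IsGK p (TrivExt (p ^ (l + 1)) h) := by
  obtain ⟨c, ι, T⟩ := IsTrivExt.exists_trivExt (NeZero.ne (p ^ (l + 1))) h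
  exact (T.isGK_and_kernel he hexp ho).1

theorem nonempty_kernel_trivExt_equiv (l : ℕ) :
    Nonempty (kernel (TrivExt (p ^ (l + 1)) h) ≃* TrivExt (p ^ l) h) := by
  obtain ⟨c, ι, T⟩ := IsTrivExt.exists_trivExt (NeZero.ne (p ^ (l + 1))) h
  obtain ⟨-, c', ι', T'⟩ := T.isGK_and_kernel he hexp ho
  obtain ⟨f⟩ := T'.nonempty_equiv
  exact ⟨f.symm⟩

theorem adj_trivExt_iff {l : ℕ} {u v : vertices p R}
    (hu : (u : IsoType) = isoType (TrivExt (p ^ (l + 1)) h)) :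
    (tree p R).Adj u v ↔ (v : IsoType) = isoType (TrivExt (p ^ l) h) := by
  have hk := isoType_eq_iff.2 (nonempty_kernel_trivExt_equiv he hexp ho l)
  constructor
  · rintro ⟨G, _, _, h1, h2, h3⟩
    obtain ⟨f⟩ := isoType_eq_iff.1 (h1.symm.trans hu)
    rw [h3, ← hk]
    exact isoType_eq_iff.2 (nonempty_kernel_equiv f)
  · intro hv
    exact ⟨_, inferInstance, inferInstance, hu, isGK_trivExt he hexp ho l, hv.trans hk.symm⟩

include hR

theorem hasRoot_trivExt (l : ℕ) : HasRoot p (TrivExt (p ^ l) h) R l := by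
  induction l with
  | zero =>
    obtain ⟨f⟩ := nonempty_trivExt_one_equiv (p := p) h
    exact hasRoot_zero hR f
  | succ l ih =>
    obtain ⟨f⟩ := nonempty_kernel_trivExt_equiv he hexp ho l
    exact ih.succ (isGK_trivExt he hexp ho l) f

theorem isoType_trivExt_mem_vertices (l : ℕ) :
    isoType (TrivExt (p ^ l) h) ∈ vertices p R := by
  cases l with
  | zero => exact Or.inl (isoType_eq_iff.2 (nonempty_trivExt_one_equiv h))
  | succ l =>
    exact Or.inr ⟨_, inferInstance, inferInstance, rfl, isGK_trivExt he hexp ho l, l + 1,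
      by omega, hasRoot_trivExt he hexp hR ho _⟩

/-- The stem formed by the trivial cyclic extensions belonging to a fixed element `h`. -/
def trivStem : Stem p R :=
  ⟨fun l => ⟨isoType (TrivExt (p ^ l) h), isoType_trivExt_mem_vertices he hexp hR ho l⟩,
    Subtype.ext (isoType_eq_iff.2 (nonempty_trivExt_one_equiv h)),
    fun _ => (adj_trivExt_iff he hexp ho rfl).2 rfl⟩

end

/-! ### The stems of the tree of `R` -/

section
variable {p e : ℕ} [hp : Fact p.Prime]

/-- Modulo a maximal subgroup avoiding the central element `w`, the element `x` is a power of `w`;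
but no `x * w ^ k` has order less than `p ^ e`. -/
theorem not_isGK_R (hodd : Odd p) (he : 1 ≤ e) : ¬ IsGK p (R (p ^ e)) := by
  rintro ⟨-, -, M, hM, hMk⟩
  have hmem : ∀ g, g ∈ M ↔ orderOf g < p ^ e := fun g => by
    rw [← SetLike.mem_coe, hMk, kernelSet, Set.mem_ofPred_eq, exponent_R_pow hodd]
  have hwc : ∀ k : ℤ, w (p ^ e) ^ k ∈ Subgroup.center (R (p ^ e)) := fun k =>
    zpow_mem ((mem_center_R_iff _).2 ⟨1, 0, by simp⟩) k
  have hwM : w (p ^ e) ∉ M := by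
    have h1 := (w_pow_mul_z_pow_mem_maxCentral_iff (e := e) hodd he (i := 1) (j := 0)).2
      (fun h => hp.1.one_lt.ne' (Nat.dvd_one.1 h.1))
    rw [pow_one, pow_zero, mul_one] at h1
    rw [hmem, h1.2, exponent_R_pow hodd]
    exact lt_irrefl _
  have hnormal : (Subgroup.zpowers (w (p ^ e))).Normal := by
    refine ⟨fun g hg r => ?_⟩
    obtain ⟨k, rfl⟩ := hg
    simp only
    rw [Subgroup.mem_center_iff.1 (hwc k) r, mul_inv_cancel_right]
    exact ⟨k, rfl⟩
  have htop : M ⊔ Subgroup.zpowers (w (p ^ e)) = ⊤ :=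
    hM.2 _ (left_lt_sup.2 fun h => hwM (h (Subgroup.mem_zpowers _)))
  obtain ⟨m, hm, _, ⟨k, rfl⟩, hmk⟩ := Subgroup.mem_sup_of_normal_right.1
    (htop ▸ Subgroup.mem_top (x (p ^ e)) : x (p ^ e) ∈ M ⊔ Subgroup.zpowers (w (p ^ e)))
  -- modulo `⟨w⟩` the element `m` agrees with `x`, so it has order `p ^ e`
  have h2 : m.2.right = Multiplicative.ofAdd 1 := by
    have := congrArg (fun g : R (p ^ e) => g.2.right) hmk
    simpa [w, x] using this
  have h3 := congrArg (fun g : R (p ^ e) => g.2.right.toAdd) (pow_orderOf_eq_one m)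
  simp only [(R_pow (p ^ e) m (orderOf m)).2.1, h2, toAdd_ofAdd, mul_one] at h3
  have h4 := Nat.le_of_dvd ?_ ((ZMod.natCast_eq_zero_iff _ _).1 h3)
  · exact absurd ((hmem m).1 hm) (not_lt.2 h4)
  · exact Nat.pos_of_ne_zero fun h0 => by
      have := R_pow_eq_one (p ^ e) hodd.pow m
      rw [orderOf_eq_zero_iff'] at h0
      exact h0 _ (pow_pos hp.1.pos e) this

/-- The representative `baseO` of the orbit `𝒪_a`, as an element of the centre. -/
def baseC (p e a : ℕ) [Fact p.Prime] : Subgroup.center (R (p ^ e)) :=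
  ⟨baseO p e a, (mem_center_R_iff _).2 ⟨p ^ a, 1, by simp [baseO]⟩⟩

theorem orderOf_of_mem_O (hodd : Odd p) (he : 1 ≤ e) {a : ℕ} (ha : a ≤ e) {h : R (p ^ e)}
    (hh : h ∈ O p e a) : orderOf h = p ^ e :=
  (O_subset_maxCentral hodd he ha hh).2.trans (exponent_R_pow hodd)

theorem orderOf_baseC (hodd : Odd p) (he : 1 ≤ e) {a : ℕ} (ha : a ≤ e) :
    orderOf (baseC p e a : R (p ^ e)) = p ^ e :=
  orderOf_of_mem_O hodd he ha (baseO_mem_O he ha)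

/-- The isomorphism type of level `l` on the stem belonging to `𝒪_a`. -/
def stemType (p e a l : ℕ) [Fact p.Prime] : IsoType := isoType (TrivExt (p ^ l) (baseC p e a))

theorem isoType_trivExt_eq_stemType (hodd : Odd p) (he : 1 ≤ e) {a : ℕ} (ha : a ≤ e)
    {h : Subgroup.center (R (p ^ e))} (hh : (h : R (p ^ e)) ∈ O p e a) (l : ℕ) :
    isoType (TrivExt (p ^ l) h) = stemType p e a l := by
  refine isoType_eq_iff.2 ?_
  rcases Nat.eq_zero_or_pos l with rfl | hl
  · obtain ⟨f⟩ := nonempty_trivExt_one_equiv (p := p) h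
    obtain ⟨g⟩ := nonempty_trivExt_one_equiv (p := p) (baseC p e a)
    exact ⟨f.trans g.symm⟩
  · obtain ⟨f⟩ := (nonempty_trivExt_equiv_iff he hl (exponent_R_pow hodd)
      (orderOf_baseC hodd he ha) (orderOf_of_mem_O hodd he ha hh)).2
      (permRel_baseO hodd he ha hh l)
    exact ⟨f.symm⟩

theorem stemType_eq_iff (hodd : Odd p) (he : 1 ≤ e) {a b l : ℕ} (ha : a ≤ e) (hb : b ≤ e) :
    stemType p e a l = stemType p e b l ↔ a = b ∨ (l ≤ a ∧ l ≤ b) := by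
  rcases Nat.eq_zero_or_pos l with rfl | hl
  · simp only [zero_le, and_self, or_true, iff_true]
    obtain ⟨f⟩ := nonempty_trivExt_one_equiv (p := p) (baseC p e a)
    obtain ⟨g⟩ := nonempty_trivExt_one_equiv (p := p) (baseC p e b)
    exact isoType_eq_iff.2 ⟨f.trans g.symm⟩
  · constructor
    · intro h
      have hrel := (nonempty_trivExt_equiv_iff he hl (exponent_R_pow hodd)
        (orderOf_baseC hodd he ha) (orderOf_baseC hodd he hb)).1 (isoType_eq_iff.1 h)
      have key : ∀ c ≤ l, c ≤ e → (c ≤ b ↔ c ≤ a) := fun c hc hce => by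
        rw [← mem_powCommutator_of_mem_O he ha hce (baseO_mem_O (p := p) he ha),
          ← mem_powCommutator_of_mem_O he hb hce (baseO_mem_O (p := p) he hb)]
        exact hrel.mem_powCommutator_iff hc
      by_contra! hne
      rcases lt_or_gt_of_ne hne.1 with hab | hab
      · have := key (a + 1)
        omega
      · have := key (b + 1)
        omega
    · rintro (rfl | ⟨hla, hlb⟩)
      · rfl
      · have aux : ∀ c, l ≤ c → c ≤ e → stemType p e e l = stemType p e c l := by
          intro c hlc hce
          refine isoType_eq_iff.2 ((nonempty_trivExt_equiv_iff he hl (exponent_R_pow hodd)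
            (orderOf_baseC hodd he le_rfl) (orderOf_baseC hodd he hce)).2 ?_)
          refine permRel_z hodd he hl (by omega) ?_
          simp only [Otilde, Set.mem_iUnion, Set.mem_Icc, exists_prop]
          exact ⟨c, ⟨hlc, hce⟩, baseO_mem_O he hce⟩
        exact (aux a hla ha).symm.trans (aux b hlb hb)

theorem Stem.exists_eq_stemType (hodd : Odd p) (he : 1 ≤ e) (s : Stem p (R (p ^ e))) (l : ℕ) :
    ∃ a, a ≤ e ∧ (s.at l : IsoType) = stemType p e a l := by
  obtain ⟨G, _, _, hG⟩ := exists_isoType_eq (s.at l : IsoType)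
  obtain ⟨h, c, ι, hh, T⟩ := s.exists_isTrivExt hG
  obtain ⟨a, ha, hha⟩ := exists_mem_O_of_mem_maxCentral hodd he hh
  refine ⟨a, ha, ?_⟩
  exact hG.trans ((isoType_eq_of_isTrivExt (h := ⟨h, hh.1⟩) T).trans
    (isoType_trivExt_eq_stemType hodd he ha hha l))

/-- The stem belonging to the orbit `𝒪_a`. -/
def stemO (hodd : Odd p) (he : 1 ≤ e) {a : ℕ} (ha : a ≤ e) : Stem p (R (p ^ e)) :=
  trivStem he (exponent_R_pow hodd) (not_isGK_R hodd he) (orderOf_baseC hodd he ha)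

theorem stemO_at (hodd : Odd p) (he : 1 ≤ e) {a : ℕ} (ha : a ≤ e) (l : ℕ) :
    ((stemO hodd he ha).at l : IsoType) = stemType p e a l := rfl

theorem Stem.at_eq_of_at_succ_eq (hodd : Odd p) (he : 1 ≤ e) (s : Stem p (R (p ^ e)))
    {a l : ℕ} (ha : a ≤ e) (hs : (s.at (l + 1) : IsoType) = stemType p e a (l + 1)) :
    (s.at l : IsoType) = stemType p e a l :=
  (adj_trivExt_iff he (exponent_R_pow hodd) (orderOf_baseC hodd he ha) hs).1 (s.2.2 l)

/-- From level `e` on the types belonging to different orbits are distinct, so a stem cannot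
change its orbit there; below level `e` it is determined by its vertices above. -/
theorem Stem.exists_eq_stemO (hodd : Odd p) (he : 1 ≤ e) (s : Stem p (R (p ^ e))) :
    ∃ (a : ℕ) (ha : a ≤ e), s = stemO hodd he ha := by
  obtain ⟨a, ha, hs⟩ := s.exists_eq_stemType hodd he e
  have hup : ∀ m, (s.at (e + m) : IsoType) = stemType p e a (e + m) := by
    intro m
    induction m with
    | zero => exact hs
    | succ m ih =>
      obtain ⟨b, hb, hsb⟩ := s.exists_eq_stemType hodd he (e + m + 1)
      have h1 := s.at_eq_of_at_succ_eq hodd he hb hsb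
      rw [ih] at h1
      have h2 := (stemType_eq_iff hodd he ha hb).1 h1
      obtain rfl : a = b := by omega
      exact hsb
  have hdown : ∀ m l, (s.at (l + m) : IsoType) = stemType p e a (l + m) →
      (s.at l : IsoType) = stemType p e a l := by
    intro m
    induction m with
    | zero => exact fun l h => h
    | succ m ih => exact fun l h => ih l (s.at_eq_of_at_succ_eq hodd he ha h)
  refine ⟨a, ha, Subtype.ext (funext fun l => Subtype.ext (hdown e l ?_))⟩
  rw [add_comm]
  exact hup l

/-- The children of a vertex which lie on stems come from the stems through that vertex. -/
theorem mem_stemChildren_iff (hodd : Odd p) (he : 1 ≤ e) {a l : ℕ} (ha : a ≤ e)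
    (u : vertices p (R (p ^ e))) :
    u ∈ stemChildren p (R (p ^ e)) ((stemO hodd he ha).at l) ↔
      ∃ b, ∃ hb : b ≤ e, (a = b ∨ (l ≤ a ∧ l ≤ b)) ∧ u = (stemO hodd he hb).at (l + 1) := by
  constructor
  · rintro ⟨⟨s, m, rfl⟩, hadj⟩
    obtain ⟨b, hb, rfl⟩ := s.exists_eq_stemO hodd he
    cases m with
    | zero =>
      obtain ⟨G, _, _, h1, h2, -⟩ := hadj
      rw [Stem.at, (stemO hodd he hb).2.1] at h1
      obtain ⟨f⟩ := isoType_eq_iff.1 h1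
      exact absurd (h2.of_equiv f.symm) (not_isGK_R hodd he)
    | succ m =>
      have h1 := (adj_trivExt_iff he (exponent_R_pow hodd) (orderOf_baseC hodd he hb)
        (stemO_at hodd he hb (m + 1))).1 hadj
      obtain rfl : l = m := eq_of_isoType_trivExt_eq h1
      exact ⟨b, hb, (stemType_eq_iff hodd he ha hb).1 h1, rfl⟩
  · rintro ⟨b, hb, hab, rfl⟩
    refine ⟨⟨_, _, rfl⟩, ?_⟩
    have h1 : (stemO hodd he ha).at l = (stemO hodd he hb).at l :=
      Subtype.ext ((stemType_eq_iff hodd he ha hb).2 hab)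
    rw [h1]
    exact (stemO hodd he hb).2.2 l

theorem stemO_at_eq_iff (hodd : Odd p) (he : 1 ≤ e) {a b l : ℕ} (ha : a ≤ e) (hb : b ≤ e) :
    (stemO hodd he ha).at l = (stemO hodd he hb).at l ↔ a = b ∨ (l ≤ a ∧ l ≤ b) :=
  Subtype.ext_iff.trans (stemType_eq_iff hodd he ha hb)

theorem infinite_vertices_R (hodd : Odd p) (he : 1 ≤ e) : Infinite (vertices p (R (p ^ e))) :=
  Infinite.of_injective (fun l => (stemO hodd he le_rfl).at l) fun _ _ h =>
    eq_of_isoType_trivExt_eq (congrArg Subtype.val h)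

theorem exponent_center_R (hodd : Odd p) (he : 1 ≤ e) :
    Monoid.exponent (Subgroup.center (R (p ^ e))) = p ^ e := by
  refine Nat.dvd_antisymm (Monoid.exponent_dvd_of_forall_pow_eq_one fun g =>
    Subtype.ext (R_pow_eq_one _ hodd.pow _)) ?_
  have h1 := Monoid.order_dvd_exponent (baseC p e e)
  rwa [← Subgroup.orderOf_coe, orderOf_baseC hodd he le_rfl] at h1

end

end GKTrees

end

theorem mainTheorem10 (p e : ℕ) [Fact p.Prime] (hp : Odd p) (he : 1 ≤ e) :
    -- `R` is a finite `p`-group not of GK type, and `T(R)` is infinite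
    IsPGroup p (GKTrees.R (p ^ e)) ∧
    Group.rank (GKTrees.R (p ^ e)) = 3 ∧
    Monoid.exponent (GKTrees.R (p ^ e)) = p ^ e ∧
    Monoid.exponent (Subgroup.center (GKTrees.R (p ^ e))) = p ^ e ∧
    ¬ GKTrees.IsGK p (GKTrees.R (p ^ e)) ∧
    Infinite (GKTrees.vertices p (GKTrees.R (p ^ e))) ∧
    -- intrinsic description and cardinalities of `𝒪_0, …, 𝒪_e`
    GKTrees.O p e 0 = GKTrees.maxCentral (GKTrees.R (p ^ e)) \
      (GKTrees.powSubgroup (GKTrees.R (p ^ e)) p ⊔ commutator (GKTrees.R (p ^ e)) :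
        Subgroup (GKTrees.R (p ^ e))) ∧
    (∀ a, 1 ≤ a → a < e →
      GKTrees.O p e a = GKTrees.maxCentral (GKTrees.R (p ^ e)) ∩
        ((GKTrees.powSubgroup (GKTrees.R (p ^ e)) (p ^ a) ⊔ commutator (GKTrees.R (p ^ e)) :
            Subgroup (GKTrees.R (p ^ e))) \
          (GKTrees.powSubgroup (GKTrees.R (p ^ e)) (p ^ (a + 1)) ⊔
            commutator (GKTrees.R (p ^ e)) : Subgroup (GKTrees.R (p ^ e))) :
          Set (GKTrees.R (p ^ e)))) ∧
    GKTrees.O p e e = GKTrees.maxCentral (GKTrees.R (p ^ e)) ∩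
      (GKTrees.powSubgroup (GKTrees.R (p ^ e)) (p ^ e) ⊔ commutator (GKTrees.R (p ^ e)) :
        Subgroup (GKTrees.R (p ^ e))) ∧
    (GKTrees.O p e 0).ncard = p ^ (2 * e - 1) * (p - 1) ∧
    (∀ a, 1 ≤ a → a < e →
      (GKTrees.O p e a).ncard = p ^ (2 * e - 2 - a) * (p - 1) ^ 2) ∧
    (GKTrees.O p e e).ncard = p ^ (e - 1) * (p - 1) ∧
    -- the `A_l(R)`-orbits, for `l = 1, …, e`; for `l = e` they are `𝒪_0, …, 𝒪_e`
    (∀ l, 1 ≤ l → l ≤ e →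
      GKTrees.permOrbits p (GKTrees.R (p ^ e)) l =
        {X | (∃ a < l, X = GKTrees.O p e a) ∨ X = GKTrees.Otilde p e l}) ∧
    GKTrees.permOrbits p (GKTrees.R (p ^ e)) e = {X | ∃ a ≤ e, X = GKTrees.O p e a} ∧
    (GKTrees.permOrbits p (GKTrees.R (p ^ e)) e).ncard = e + 1 ∧
    -- the stems
    ∃ S : Fin (e + 1) → GKTrees.Stem p (GKTrees.R (p ^ e)),
      -- they are parametrised by the orbits `𝒪_0, …, 𝒪_e`
      Function.Bijective S ∧
      (∀ (a : Fin (e + 1)) (h : Subgroup.center (GKTrees.R (p ^ e))),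
        (h : GKTrees.R (p ^ e)) ∈ GKTrees.O p e a → ∀ l, 1 ≤ l →
          (((S a).at l : GKTrees.vertices p (GKTrees.R (p ^ e))) : GKTrees.IsoType) =
            GKTrees.isoType (GKTrees.TrivExt (p ^ l) h)) ∧
      -- two-fold branching at each level `0, …, e - 1`, and nowhere else
      (∀ (a b : Fin (e + 1)) (l : ℕ),
        (S a).at l = (S b).at l ↔ a = b ∨ (l ≤ (a : ℕ) ∧ l ≤ (b : ℕ))) ∧
      (∀ l : Fin e,
        GKTrees.stemChildren p (GKTrees.R (p ^ e)) ((S (Fin.last e)).at l) =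
          {(S l.castSucc).at (l + 1), (S (Fin.last e)).at (l + 1)} ∧
        (S l.castSucc).at (l + 1) ≠ (S (Fin.last e)).at (l + 1)) ∧
      (∀ (a : Fin (e + 1)) (l : ℕ), ((a : ℕ) < l ∨ e ≤ l) →
        GKTrees.stemChildren p (GKTrees.R (p ^ e)) ((S a).at l) = {(S a).at (l + 1)}) ∧
      -- ranks
      (∀ l, 1 ≤ l → ((S 0).at l : GKTrees.IsoType).rank = 3) ∧
      (∀ a : Fin (e + 1), a ≠ 0 → ∀ l, 1 ≤ l → ((S a).at l : GKTrees.IsoType).rank = 4) := by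
  refine ⟨fun g => ⟨e, GKTrees.R_pow_eq_one _ hp.pow g⟩, GKTrees.rank_R he,
    GKTrees.exponent_R_pow hp, GKTrees.exponent_center_R hp he, GKTrees.not_isGK_R hp he,
    GKTrees.infinite_vertices_R hp he, ?_, ?_, ?_, GKTrees.ncard_O_zero he,
    fun a ha hae => GKTrees.ncard_O_of_lt ha hae, GKTrees.ncard_O_self he,
    fun l hl hle => GKTrees.permOrbits_R hp he hl hle, GKTrees.permOrbits_R_self hp he,
    GKTrees.ncard_permOrbits_R_self hp he,
    fun a => GKTrees.stemO hp he (Nat.lt_succ_iff.1 a.2), ⟨?_, ?_⟩, ?_, ?_, ?_, ?_, ?_, ?_⟩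
  · ext g
    rw [GKTrees.mem_O_iff_mem_powCommutator hp he (Nat.zero_le e)]
    have h0 : g ∈ GKTrees.maxCentral (GKTrees.R (p ^ e)) →
        g ∈ GKTrees.powCommutator (GKTrees.R (p ^ e)) (p ^ 0) := fun _ =>
      Subgroup.mem_sup_left (Subgroup.subset_closure ⟨g, by simp⟩)
    rw [zero_add, pow_one]
    exact ⟨fun h => ⟨h.1, h.2.2 he⟩, fun h => ⟨h.1, h0 h.1, fun _ => h.2⟩⟩
  · intro a ha hae
    ext g
    rw [GKTrees.mem_O_iff_mem_powCommutator hp he hae.le]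
    exact ⟨fun h => ⟨h.1, h.2.1, h.2.2 hae⟩, fun h => ⟨h.1, h.2.1, fun _ => h.2.2⟩⟩
  · ext g
    rw [GKTrees.mem_O_iff_mem_powCommutator hp he le_rfl]
    exact ⟨fun h => ⟨h.1, h.2.1⟩, fun h => ⟨h.1, h.2, fun h' => absurd h' (lt_irrefl e)⟩⟩
  · intro a b hab
    have h1 := (GKTrees.stemO_at_eq_iff hp he (l := e + 1) (Nat.lt_succ_iff.1 a.2)
      (Nat.lt_succ_iff.1 b.2)).1 (congrArg (fun s => s.at (e + 1)) hab)
    exact Fin.ext (by omega)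
  · intro s
    obtain ⟨a, ha, rfl⟩ := s.exists_eq_stemO hp he
    exact ⟨⟨a, Nat.lt_succ_iff.2 ha⟩, rfl⟩
  · intro a h hh l _
    exact (GKTrees.isoType_trivExt_eq_stemType hp he (Nat.lt_succ_iff.1 a.2) hh l).symm
  · intro a b l
    rw [GKTrees.stemO_at_eq_iff, Fin.ext_iff]
  · intro l
    have hl := l.2
    refine ⟨?_, fun h => ?_⟩
    · ext u
      simp only [GKTrees.mem_stemChildren_iff, Set.mem_insert_iff, Set.mem_singleton_iff,
        Fin.val_last, Fin.val_castSucc]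
      constructor
      · rintro ⟨b, hb, hab, rfl⟩
        rw [GKTrees.stemO_at_eq_iff, GKTrees.stemO_at_eq_iff]
        omega
      · rintro (rfl | rfl)
        · exact ⟨l, hl.le, Or.inr ⟨hl.le, le_rfl⟩, rfl⟩
        · exact ⟨e, le_rfl, Or.inl rfl, rfl⟩
    · rw [GKTrees.stemO_at_eq_iff, Fin.val_last, Fin.val_castSucc] at h
      omega
  · intro a l hal
    have ha := a.2
    ext u
    rw [GKTrees.mem_stemChildren_iff, Set.mem_singleton_iff]
    constructor
    · rintro ⟨b, hb, hab, rfl⟩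
      rw [GKTrees.stemO_at_eq_iff]
      omega
    · rintro rfl
      exact ⟨a, Nat.lt_succ_iff.1 ha, Or.inl rfl, rfl⟩
  · intro l hl
    exact GKTrees.rank_trivExt_baseO_zero he hl rfl
  · intro a ha l hl
    exact GKTrees.rank_trivExt_baseO he (Nat.one_le_iff_ne_zero.2 fun h => ha (Fin.ext h)) hl rfl
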